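/- Let $n\ge 1$, $0<\beta<n/2$, and let $L_\beta=D^{-2\beta}$ be the Fourier multiplier with symbol $|\xi|^{-2\beta}$ on $\mathbb R^n$. Consider the focusing equation $$ i u_t+\Delta u-L_\beta u+|u|^2u=0,\qquad u(0)=u_0 . \tag{1}$$ Put $$\|u\|_{\dot X_\beta}^2=\|\nabla u\|_{L^2}^2+\|D^{-\beta}u\|_{L^2}^2,\qquad \|u\|_{X_\beta}^2=\|u\|_{L^2}^2+\|u\|_{\dot X_\beta}^2,$$ $$\mathbb F(u)=\|u\|_{L^2}^2,\qquad \mathbb E(u)=\tfrac12\|u\|_{\dot X_\beta}^2-\tfrac14\|u\|_{L^4}^4 ,$$ and let $X_\beta$ be the space of $u\in L^2(\mathbb R^n)$ with $\|u\|_{X_\beta}<\infty$. A solution of (1) on $[0,T)$, $0<T\le\infty$, is a function $u\in C([0,T);X_\beta)$ with $u(0)=u_0$ that satisfies Duhamel's formula for (1) and that is, on every interval $[0,T']$ with $T'<T$, a limit in $C([0,T'];X_\beta)$ of smooth solutions of the equation, that is, of solutions in $\bigcap_s C([0,T'];H^s_\beta)$, where $\|v\|_{H^s_\beta}=\||\xi|^{-\beta}\langle\xi\rangle^{s+\beta}\hat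 v\|_{L^2}$. Let $\kappa\ge 0$ and $m\ge0$ satisfy $$0\le \frac m2\le 1-\kappa-\frac n4 ,$$ and set $$k=\frac{2(n+4\kappa)}{2-m},\qquad \theta=\frac{2(4-2m-4\kappa-n)}{m-2+4\kappa+n},\qquad c_{\beta,m}=\Big((\beta+1)\beta^{-\frac{\beta}{\beta+1}}\Big)^{m/2},$$ where $k>2$ is assumed (equivalently $n+4\kappa+m>2$). Let $\varrho>0$ be a constant such that $$\|u\|_{L^4}^4\le \varrho\,\|u\|_{L^2}^{4-n-4\kappa}\,\|\nabla u\|_{L^2}^{\,n+\frac{4\kappa\beta}{\beta+1}}\,\|D^{-\beta}u\|_{L^2}^{\frac{4\kappa}{\beta+1}}\qquad\text{for all }u\in X_\beta .$$ **Theorem (interpolated global conditions).** Let $u_0\in X_\beta$ satisfy $$\|u_0\|_{\dot X_\beta}^{2-m}\,\mathbb F(u_0)^{\frac{\theta+m}{2}}<\Big(\frac{4c_{\beta,m}}{\varrho k}\Big)^{\frac{2}{k-2}}$$ and $$\mathbb E(u_0)^{k-2}\,\mathbb F(u_0)^{\frac{(k-2)\theta}{2}}<c_{\beta,m}^{\,k}\Big(\frac{k-2}{2k}\Big)^{k-2}\Big(\frac{4}{\varrho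 k}\Big)^2 .$$ Then the solution of (1) with initial data $u_0$ is uniformly bounded in $X_\beta$: there is $K<\infty$, depending on $u_0$ but not on $T$, such that $\|u(t)\|_{X_\beta}\le K$ for all $t\in[0,T)$, for every solution $u$ of (1) on an interval $[0,T)$ with initial data $u_0$. -/

import Mathlib

open MeasureTheory Set Filter Topology
open scoped FourierTransform ENNReal NNReal

noncomputable section

namespace NonlocalNLS

/-- The Euclidean space `ℝⁿ`. -/
abbrev E (n : ℕ) : Type := EuclideanSpace ℝ (Fin n)

/-- The complex Hilbert space `L²(ℝⁿ)`. -/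
abbrev L2 (n : ℕ) : Type := Lp ℂ 2 (volume : Measure (E n))

/-- `‖D^s u‖_{L²}` for `D = (-Δ)^{1/2}`, with values in `[0,∞]`. The Fourier transform of Mathlib is
`∫ e^{-2πi x·ξ} u(x) dx`, so that `D` has the symbol `2π|ξ|`. By Plancherel's identity `s = 1` gives
`‖∇u‖_{L²}`, and `s = -β` gives `‖D^{-β} u‖_{L²} = ‖L_{β/2} u‖_{L²} = ⟨u, L_β u⟩^{1/2}`. -/
def eD {n : ℕ} (s : ℝ) (u : L2 n) : ℝ≥0∞ :=
  eLpNorm (fun ξ : E n => (((2 * Real.pi * ‖ξ‖) ^ s : ℝ) : ℂ) * (𝓕 u : L2 n) ξ) 2 volume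

/-- The norm of `X_β = H¹ ∩ Ḣ^{-β}` with values in `[0,∞]`:
`‖u‖²_{X_β} = ‖u‖²_{L²} + ‖∇u‖²_{L²} + ‖D^{-β}u‖²_{L²}`. -/
def eX {n : ℕ} (β : ℝ) (u : L2 n) : ℝ≥0∞ :=
  (‖u‖ₑ ^ 2 + eD 1 u ^ 2 + eD (-β) u ^ 2) ^ (1 / 2 : ℝ)

/-- `u ∈ X_β`. -/
def MemX {n : ℕ} (β : ℝ) (u : L2 n) : Prop := eX β u < ∞

/-- `‖D^s u‖_{L²}` as a real number (for `u` for which it is finite). -/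
def normD {n : ℕ} (s : ℝ) (u : L2 n) : ℝ := (eD s u).toReal

/-- The homogeneous norm `‖u‖_{Ẋ_β} = (‖∇u‖² + ‖D^{-β}u‖²)^{1/2}` of `u ∈ X_β`. -/
def normXdot {n : ℕ} (β : ℝ) (u : L2 n) : ℝ := Real.sqrt (normD 1 u ^ 2 + normD (-β) u ^ 2)

/-- The mass `𝔽(u) = ‖u‖²_{L²}`. -/
def mass {n : ℕ} (u : L2 n) : ℝ := ‖u‖ ^ 2

/-- The energy in the focusing case, with `ε = 1`:
`𝔼(u) = ½‖∇u‖²_{L²} + ½⟨u, L_β u⟩ - ¼‖u‖⁴_{L⁴}`. -/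
def energy {n : ℕ} (β : ℝ) (u : L2 n) : ℝ :=
  1 / 2 * normD 1 u ^ 2 + 1 / 2 * normD (-β) u ^ 2 - 1 / 4 * (eLpNorm u 4 volume).toReal ^ 4

/-- The norm of the modified Sobolev space `H^s_β`: `‖ |ξ|^{-β} ⟨ξ⟩^{s+β} û ‖_{L²}`, where
`⟨ξ⟩ = (1 + |ξ|²)^{1/2}` (`2πξ` is the frequency). -/
def eHs {n : ℕ} (s β : ℝ) (u : L2 n) : ℝ≥0∞ :=
  eLpNorm (fun ξ : E n => (((2 * Real.pi * ‖ξ‖) ^ (-β) *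
    Real.sqrt (1 + (2 * Real.pi * ‖ξ‖) ^ 2) ^ (s + β) : ℝ) : ℂ) * (𝓕 u : L2 n) ξ) 2 volume

/-- The dispersion relation `|2πξ|² + |2πξ|^{-2β}`, that is, the symbol of `-Δ + L_β`. -/
def symb {n : ℕ} (β : ℝ) (ξ : E n) : ℝ :=
  (2 * Real.pi * ‖ξ‖) ^ 2 + (2 * Real.pi * ‖ξ‖) ^ (-(2 * β))

/-- The (classical) Fourier transform of the nonlinearity `|u|² u`, which is integrable when
`u ∈ X_β` and `n ≤ 4`. -/
def cubicHat {n : ℕ} (u : L2 n) (ξ : E n) : ℂ :=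
  𝓕 (fun x : E n => ((‖u x‖ ^ 2 : ℝ) : ℂ) * u x) ξ

/-- Duhamel's formula at time `t` for `i u_t + Δu - L_β u + |u|² u = 0`, on the Fourier side:
`û(t) = e^{-itm} û(0) + i ∫₀ᵗ e^{-i(t-s)m} (|u|²u)^(s) ds`. -/
def DuhamelAt {n : ℕ} (β : ℝ) (u : ℝ → L2 n) (t : ℝ) : Prop :=
  ∀ᵐ ξ : E n, (𝓕 (u t) : L2 n) ξ =
    Complex.exp (-Complex.I * t * symb β ξ) * (𝓕 (u 0) : L2 n) ξ +
      Complex.I * ∫ s in (0 : ℝ)..t,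
        Complex.exp (-Complex.I * (t - s) * symb β ξ) * cubicHat (u s) ξ

/-- `v` is a smooth solution on `[0, T]`: it belongs to `C([0, T]; H^s_β)` for every `s` and satisfies
the equation in Duhamel's form. -/
structure IsSmoothSolution {n : ℕ} (β T : ℝ) (v : ℝ → L2 n) : Prop where
  mem : ∀ s : ℝ, ∀ t ∈ Icc 0 T, eHs s β (v t) < ∞
  cont : ∀ s : ℝ, ∀ t ∈ Icc 0 T, Tendsto (fun τ => eHs s β (v τ - v t)) (𝓝[Icc 0 T] t) (𝓝 0)
  duhamel : ∀ t ∈ Icc 0 T, DuhamelAt β v t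

/-- The time interval `[0, T)`, where `0 < T ≤ ∞`. -/
def timeSet (T : EReal) : Set ℝ := {t | 0 ≤ t ∧ (t : EReal) < T}

/-- `u` is a (strong) `X_β`-solution on `[0, T)` with initial data `u₀`: it belongs to `C([0, T); X_β)`,
satisfies the equation in Duhamel's form, and on every compact subinterval it is the uniform
limit in `X_β` of smooth solutions. (The last clause is how the solution map of a locally well-posed
problem acts on `X_β`: it is the continuous extension of the one for smooth data. No conservation
law is part of the definition.) -/
structure IsSolution {n : ℕ} (β : ℝ) (T : EReal) (u₀ : L2 n) (u : ℝ → L2 n) : Prop where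
  pos : 0 < T
  init : u 0 = u₀
  mem : ∀ t ∈ timeSet T, MemX β (u t)
  cont : ∀ t ∈ timeSet T, Tendsto (fun τ => eX β (u τ - u t)) (𝓝[timeSet T] t) (𝓝 0)
  duhamel : ∀ t ∈ timeSet T, DuhamelAt β u t
  approx : ∀ T' ∈ timeSet T, ∃ v : ℕ → ℝ → L2 n, (∀ j, IsSmoothSolution β T' (v j)) ∧
    Tendsto (fun j => ⨆ t ∈ Icc 0 T', eX β (v j t - u t)) atTop (𝓝 0)

/-- `ϱ` is an admissible constant in the embedding of `X_β` into `L⁴`: for all `u ∈ X_β`,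
`‖u‖⁴_{L⁴} ≤ ϱ ‖u‖_{L²}^{4-n-4κ} ‖∇u‖_{L²}^{n+4κβ/(β+1)} ‖L_{β/2}u‖_{L²}^{4κ/(β+1)}`. -/
def IsEmbeddingConstant (n : ℕ) (β κ ϱ : ℝ) : Prop :=
  ∀ u : L2 n, MemX β u →
    eLpNorm u 4 volume ^ 4 ≤ ENNReal.ofReal (ϱ * ‖u‖ ^ (4 - n - 4 * κ) *
      normD 1 u ^ (n + 4 * κ * β / (β + 1)) * normD (-β) u ^ (4 * κ / (β + 1)))

/-- The constant `c_{β,m} = ((β+1) β^{-β/(β+1)})^{m/2}`. -/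
def cConst (β m : ℝ) : ℝ := (β + 1) ^ (m / 2) * β ^ (-(m * β / (2 * (β + 1))))

/-- The exponent `k = 2 (n + 4κ) / (2 - m)`. -/
def kExp (n : ℕ) (κ m : ℝ) : ℝ := 2 * (n + 4 * κ) / (2 - m)

/-- The exponent `θ = 2 (4 - 2m - 4κ - n) / (m - 2 + 4κ + n)`. -/
def thetaExp (n : ℕ) (κ m : ℝ) : ℝ := 2 * (4 - 2 * m - 4 * κ - n) / (m - 2 + 4 * κ + n)

end NonlocalNLS

end

open NonlocalNLS

namespace NonlocalNLS

/-! The theorem is a potential-well argument. Let `μ` be the `L²` norm of `u`, a conserved quantity,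
and put `y = ‖u‖_{Ẋ_β}^{2-m}`. The symbol `r² + r^{-2β}` has the positive minimum `cConst β 2`, so
`m` of the powers of the `Ẋ_β` norm can be traded for `c μ^m`. With the embedding into `L⁴` this
bounds the energy below by `f(y) = ½ c μ^m y - ¼ ϱ μ^{4-n-4κ} y^{k/2}` (`le_energy`). For `μ > 0`
the function `f` is concave, as `k > 2`, with maximum at some `y₁`; the two hypotheses say that
`y(0) < y₁` and that the energy is below `f(y₁)` (`critical_value`). Since the energy is constant
and `y(t)` is continuous, `y` can never reach `y₁`, and this bounds the `Ẋ_β` norm for all time.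

Most of the file proves the conservation laws, which the notion of solution does not contain. They
are shown for smooth solutions and pass to the limit by continuity of mass and energy on `X_β`
(`IsSolution.conservation`). For a smooth solution only right derivatives are needed. In the
interaction picture Duhamel's formula writes the increment from `s` to `t` as `i (t - s)` times a
mean force, and the phase has modulus one, so the slope of any quadratic Fourier functional is an
explicit pairing (`IsSmoothSolution.hasDerivWithinAt_quadratic`). The symbol is singular at the
origin; it is split as `wt * wtDual`, with `wt` carried by the solution and `wtDual` by the force.
The force has a bounded Fourier transform, so `β < n/2` suffices there. The `L⁴` term is expanded to
first order, with a remainder of order `‖v t - v s‖² = o(t - s)`. Both parts of the energy then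
change at a rate given by the same `energyPairing`, and the two rates cancel. -/

/-! ### The Fourier transform on `L¹ ∩ L²`. -/

theorem continuous_fourier_of_integrable {n : ℕ} {f : E n → ℂ} (h1 : Integrable f) :
    Continuous (𝓕 f) :=
  VectorFourier.fourierIntegral_continuous Real.continuous_fourierChar continuous_inner h1

/-- On `L¹ ∩ L²` the classical Fourier transform agrees with the one of `L²`. -/
theorem fourier_toLp_ae_eq {n : ℕ} {f : E n → ℂ} (h1 : Integrable f) (h2 : MemLp f 2) :
    (𝓕 (h2.toLp f : L2 n) : L2 n) =ᵐ[volume] 𝓕 f := by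
  have hc : Continuous (𝓕 f) := continuous_fourier_of_integrable h1
  refine ae_eq_of_integral_contDiff_smul_eq ?_ hc.locallyIntegrable ?_
  · exact (Lp.memLp _).locallyIntegrable (by norm_num)
  intro g hg hgc
  have hgc' : HasCompactSupport (fun x => (g x : ℂ)) := hgc.comp_left (g := fun x : ℝ => (x : ℂ)) rfl
  let G : SchwartzMap (E n) ℂ := hgc'.toSchwartzMap (Complex.ofRealCLM.contDiff.comp hg)
  have hG : ∀ x, G x = g x := fun x => rfl
  -- The `L²` transform is compatible with that of tempered distributions, so tested against `G` it
  -- moves onto `G`. The classical transform does the same by Fubini, which makes both sides agree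
  -- against every bump function.
  have e1 := congrArg (fun T => T G) (Lp.fourier_toTemperedDistribution_eq (h2.toLp f : L2 n))
  simp only [TemperedDistribution.fourier_apply, Lp.toTemperedDistribution_apply] at e1
  have e2 : ∫ x, g x • (𝓕 (h2.toLp f : L2 n) : L2 n) x = ∫ x, G x • (𝓕 (h2.toLp f : L2 n) : L2 n) x := by
    simp [hG]
  rw [e2, ← e1]
  have e3 : ∫ x, g x • 𝓕 f x = ∫ x, G x • 𝓕 f x := by simp [hG]
  rw [e3]
  have e4 : ∫ x, (𝓕 G) x • (h2.toLp f : L2 n) x = ∫ x, (𝓕 G) x • f x :=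
    integral_congr_ae (h2.coeFn_toLp.mono fun x hx => by simp only [hx])
  rw [e4]
  have := VectorFourier.integral_fourierIntegral_smul_eq_flip (μ := (volume : Measure (E n)))
    (ν := (volume : Measure (E n))) (L := innerₗ (E n)) (f := G) (g := f)
    Real.continuous_fourierChar continuous_inner G.integrable h1
  rw [flip_innerₗ] at this
  exact this

/-- On `L¹ ∩ L²` the classical inverse Fourier transform agrees with the one of `L²`. -/
theorem fourierInv_toLp_ae_eq {n : ℕ} {f : E n → ℂ} (h1 : Integrable f) (h2 : MemLp f 2) :
    (𝓕⁻ (h2.toLp f : L2 n) : L2 n) =ᵐ[volume] 𝓕⁻ f := by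
  have hc : Continuous (𝓕⁻ f) := by
    rw [Real.fourierInv_eq_fourier_comp_neg]
    exact continuous_fourier_of_integrable h1.comp_neg
  refine ae_eq_of_integral_contDiff_smul_eq ?_ hc.locallyIntegrable ?_
  · exact (Lp.memLp _).locallyIntegrable (by norm_num)
  intro g hg hgc
  have hgc' : HasCompactSupport (fun x => (g x : ℂ)) := hgc.comp_left (g := fun x : ℝ => (x : ℂ)) rfl
  let G : SchwartzMap (E n) ℂ := hgc'.toSchwartzMap (Complex.ofRealCLM.contDiff.comp hg)
  have hG : ∀ x, G x = g x := fun x => rfl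
  have e1 := congrArg (fun T => T G) (Lp.fourierInv_toTemperedDistribution_eq (h2.toLp f : L2 n))
  simp only [TemperedDistribution.fourierInv_apply, Lp.toTemperedDistribution_apply] at e1
  have e2 : ∫ x, g x • (𝓕⁻ (h2.toLp f : L2 n) : L2 n) x = ∫ x, G x • (𝓕⁻ (h2.toLp f : L2 n) : L2 n) x := by
    simp [hG]
  rw [e2, ← e1]
  have e3 : ∫ x, g x • 𝓕⁻ f x = ∫ x, G x • 𝓕⁻ f x := by simp [hG]
  rw [e3]
  have e4 : ∫ x, (𝓕⁻ G) x • (h2.toLp f : L2 n) x = ∫ x, (𝓕⁻ G) x • f x :=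
    integral_congr_ae (h2.coeFn_toLp.mono fun x hx => by simp only [hx])
  rw [e4]
  -- The inverse transform is the Fourier integral for the form `-⟨x, ξ⟩`, which is symmetric, so
  -- the same duality applies.
  have := VectorFourier.integral_fourierIntegral_smul_eq_flip (μ := (volume : Measure (E n)))
    (ν := (volume : Measure (E n))) (L := -innerₗ (E n)) (f := G) (g := f)
    Real.continuous_fourierChar (by simpa using! continuous_inner.neg) G.integrable h1
  have hfl : (-innerₗ (E n)).flip = -innerₗ (E n) := by
    ext; simp [real_inner_comm]
  have hinv : ∀ g : E n → ℂ,
      VectorFourier.fourierIntegral Real.fourierChar volume (-innerₗ (E n)) g = 𝓕⁻ g := by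
    intro g
    ext ξ
    simp [VectorFourier.fourierIntegral, Real.fourierInv_eq]
  rw [hfl, hinv, hinv, ← SchwartzMap.fourierInv_coe] at this
  exact this

/-- A function of `L²` whose Fourier transform is integrable is bounded by the `L¹`-norm of the
latter. -/
theorem enorm_le_of_fourier_integrable {n : ℕ} (u : L2 n)
    (h : Integrable ((𝓕 u : L2 n) : E n → ℂ)) :
    ∀ᵐ x, ‖u x‖ₑ ≤ eLpNorm ((𝓕 u : L2 n) : E n → ℂ) 1 volume := by
  have h2 : MemLp ((𝓕 u : L2 n) : E n → ℂ) 2 := Lp.memLp _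
  have := fourierInv_toLp_ae_eq h h2
  rw [Lp.toLp_coeFn, FourierTransform.fourierInv_fourier_eq] at this
  filter_upwards [this] with x hx
  rw [hx, eLpNorm_one_eq_lintegral_enorm, Real.fourierInv_eq']
  refine (enorm_integral_le_lintegral_enorm _).trans (lintegral_mono fun ξ => ?_)
  rw [enorm_smul]
  simp [← ofReal_norm, Complex.norm_exp]

/-- `|𝓕 f| ≤ ‖f‖_{L¹}`. -/
theorem enorm_fourier_le {n : ℕ} (f : E n → ℂ) (ξ : E n) :
    ‖𝓕 f ξ‖ₑ ≤ eLpNorm f 1 volume := by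
  rw [eLpNorm_one_eq_lintegral_enorm, Real.fourier_eq']
  refine (enorm_integral_le_lintegral_enorm _).trans (lintegral_mono fun ξ => ?_)
  rw [enorm_smul]
  simp [← ofReal_norm, Complex.norm_exp]

/-- `f - g` has the Fourier transform `𝓕 f - 𝓕 g`. -/
theorem fourier_sub_of_integrable {n : ℕ} {f g : E n → ℂ} (hf : Integrable f) (hg : Integrable g) :
    𝓕 (fun x => f x - g x) = fun ξ => 𝓕 f ξ - 𝓕 g ξ := by
  ext ξ
  simp only [Real.fourier_eq']
  rw [← integral_sub]
  · simp only [smul_sub]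
  · simpa [Real.fourierChar_apply, Circle.smul_def] using
      (Real.fourierIntegral_convergent_iff (μ := volume) ξ).2 hf
  · simpa [Real.fourierChar_apply, Circle.smul_def] using
      (Real.fourierIntegral_convergent_iff (μ := volume) ξ).2 hg

theorem memLp_fourier {n : ℕ} {f : E n → ℂ} (h1 : Integrable f) (h2 : MemLp f 2) :
    MemLp (𝓕 f) 2 :=
  (memLp_congr_ae (fourier_toLp_ae_eq h1 h2)).1 (Lp.memLp _)

theorem eLpNorm_fourier {n : ℕ} {f : E n → ℂ} (h1 : Integrable f) (h2 : MemLp f 2) :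
    eLpNorm (𝓕 f) 2 volume = eLpNorm f 2 volume := by
  rw [← eLpNorm_congr_ae (fourier_toLp_ae_eq h1 h2), ← eLpNorm_congr_ae h2.coeFn_toLp,
    ← Lp.enorm_def, ← Lp.enorm_def, ← ofReal_norm, ← ofReal_norm, Lp.norm_fourier_eq]

/-- Plancherel's identity for a function of `L²` and one of `L¹ ∩ L²`. -/
theorem integral_fourier_mul_conj {n : ℕ} {f : E n → ℂ} (h1 : Integrable f) (h2 : MemLp f 2)
    (u : L2 n) :
    ∫ ξ, (starRingEnd ℂ) (𝓕 f ξ) * (𝓕 u : L2 n) ξ = ∫ x, (starRingEnd ℂ) (f x) * u x := by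
  have h := Lp.inner_fourier_eq (h2.toLp f : L2 n) u
  rw [L2.inner_def, L2.inner_def] at h
  have e1 : ∫ ξ, (starRingEnd ℂ) (𝓕 f ξ) * (𝓕 u : L2 n) ξ =
      ∫ ξ, inner ℂ ((𝓕 (h2.toLp f : L2 n) : L2 n) ξ) ((𝓕 u : L2 n) ξ) := by
    refine integral_congr_ae ?_
    filter_upwards [fourier_toLp_ae_eq h1 h2] with ξ hξ
    rw [hξ, RCLike.inner_apply, mul_comm]
  rw [e1, h]
  refine integral_congr_ae ?_
  filter_upwards [h2.coeFn_toLp] with ξ hξ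
  rw [hξ, RCLike.inner_apply, mul_comm]

/-! ### The weight of `H⁴_β` and its dual weight. -/

/-- The weight of `H⁴_β`. -/
noncomputable def wt {n : ℕ} (β : ℝ) (ξ : E n) : ℝ :=
  (2 * Real.pi * ‖ξ‖) ^ (-β) * Real.sqrt (1 + (2 * Real.pi * ‖ξ‖) ^ 2) ^ ((4 : ℝ) + β)

/-- The weight dual to `wt` with respect to the symbol of the linear part. -/
noncomputable def wtDual {n : ℕ} (β : ℝ) (ξ : E n) : ℝ := symb β ξ / wt β ξ

theorem eHs_four {n : ℕ} (β : ℝ) (u : L2 n) :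
    eHs 4 β u = eLpNorm (fun ξ => (wt β ξ : ℂ) * (𝓕 u : L2 n) ξ) 2 volume := rfl

@[fun_prop]
theorem measurable_wt {n : ℕ} (β : ℝ) : Measurable (wt (n := n) β) := by
  unfold wt; fun_prop

@[fun_prop]
theorem measurable_symb {n : ℕ} (β : ℝ) : Measurable (symb (n := n) β) := by
  unfold symb; fun_prop

@[fun_prop]
theorem measurable_wtDual {n : ℕ} (β : ℝ) : Measurable (wtDual (n := n) β) :=
  (measurable_symb β).div (measurable_wt β)

section pointwise

variable {n : ℕ} {β : ℝ} {ξ : E n}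

theorem freq_pos (hξ : ξ ≠ 0) : 0 < 2 * Real.pi * ‖ξ‖ := by
  have := norm_pos_iff.2 hξ
  positivity

theorem one_le_sqrt_one_add_sq (r : ℝ) : 1 ≤ Real.sqrt (1 + r ^ 2) :=
  Real.one_le_sqrt.2 (by nlinarith [sq_nonneg r])

theorem le_sqrt_one_add_sq (r : ℝ) : r ≤ Real.sqrt (1 + r ^ 2) :=
  Real.le_sqrt_of_sq_le (by linarith)

/-- Since `r ≤ ⟨r⟩`, the factor `r^{-β} ⟨r⟩^β` is at least one, and `⟨r⟩⁴` remains. -/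
theorem sqrt_pow_four_le_wt (hβ : 0 < β) (hξ : ξ ≠ 0) :
    (1 + (2 * Real.pi * ‖ξ‖) ^ 2) ^ 2 ≤ wt β ξ := by
  have hr := freq_pos hξ
  unfold wt
  set r := 2 * Real.pi * ‖ξ‖
  have h1 := one_le_sqrt_one_add_sq r
  have h2 := le_sqrt_one_add_sq r
  set b := Real.sqrt (1 + r ^ 2) with hb
  have hb2 : 1 + r ^ 2 = b ^ 2 := (Real.sq_sqrt (by positivity)).symm
  have h3 : 1 ≤ r ^ (-β) * b ^ β := by
    rw [Real.rpow_neg hr.le, inv_mul_eq_div, one_le_div (by positivity)]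
    exact Real.rpow_le_rpow hr.le h2 hβ.le
  have h4 : b ^ ((4 : ℝ) + β) = b ^ 4 * b ^ β := by
    rw [Real.rpow_add (by positivity)]; norm_cast
  rw [h4, hb2]
  calc (b ^ 2) ^ 2 = b ^ 4 * 1 := by ring
    _ ≤ b ^ 4 * (r ^ (-β) * b ^ β) := by gcongr
    _ = _ := by ring

theorem one_le_wt (hβ : 0 < β) (hξ : ξ ≠ 0) : 1 ≤ wt β ξ := by
  refine le_trans ?_ (sqrt_pow_four_le_wt hβ hξ)
  nlinarith [sq_nonneg (2 * Real.pi * ‖ξ‖)]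

theorem wt_pos (hβ : 0 < β) (hξ : ξ ≠ 0) : 0 < wt β ξ := one_pos.trans_le (one_le_wt hβ hξ)

theorem freq_sq_le_wt (hβ : 0 < β) (hξ : ξ ≠ 0) : (2 * Real.pi * ‖ξ‖) ^ 2 ≤ wt β ξ := by
  refine le_trans ?_ (sqrt_pow_four_le_wt hβ hξ)
  nlinarith [sq_nonneg (2 * Real.pi * ‖ξ‖)]

theorem freq_le_wt (hβ : 0 < β) (hξ : ξ ≠ 0) : 2 * Real.pi * ‖ξ‖ ≤ wt β ξ := by
  refine le_trans ?_ (sqrt_pow_four_le_wt hβ hξ)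
  nlinarith [sq_nonneg (2 * Real.pi * ‖ξ‖), sq_nonneg (2 * Real.pi * ‖ξ‖ - 1)]

theorem freq_rpow_neg_le_wt (hβ : 0 < β) (hξ : ξ ≠ 0) :
    (2 * Real.pi * ‖ξ‖) ^ (-β) ≤ wt β ξ := by
  have hr := freq_pos hξ
  unfold wt
  exact le_mul_of_one_le_right (by positivity)
    (Real.one_le_rpow (one_le_sqrt_one_add_sq _) (by positivity))

theorem freq_rpow_neg_sq :
    (2 * Real.pi * ‖ξ‖) ^ (-(2 * β)) = ((2 * Real.pi * ‖ξ‖) ^ (-β)) ^ 2 := by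
  rw [← Real.rpow_natCast, ← Real.rpow_mul (by positivity)]
  congr 1; push_cast; ring

theorem symb_eq :
    symb β ξ = (2 * Real.pi * ‖ξ‖) ^ 2 + ((2 * Real.pi * ‖ξ‖) ^ (-β)) ^ 2 := by
  rw [symb, freq_rpow_neg_sq]

theorem symb_pos (hξ : ξ ≠ 0) : 0 < symb β ξ := by
  have hr := freq_pos hξ
  unfold symb
  positivity

theorem symb_nonneg : 0 ≤ symb β ξ := by
  unfold symb
  positivity

theorem symb_le_wt_sq (hβ : 0 < β) (hξ : ξ ≠ 0) : symb β ξ ≤ 2 * wt β ξ ^ 2 := by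
  have hr := freq_pos hξ
  rw [symb_eq]
  have h1 := pow_le_pow_left₀ hr.le (freq_le_wt hβ hξ) 2
  have h2 := pow_le_pow_left₀ (by positivity) (freq_rpow_neg_le_wt hβ hξ) 2
  linarith

theorem wt_mul_wtDual (hβ : 0 < β) (hξ : ξ ≠ 0) : wt β ξ * wtDual β ξ = symb β ξ := by
  have := (wt_pos hβ hξ).ne'
  unfold wtDual
  field_simp

theorem wtDual_nonneg (hβ : 0 < β) (hξ : ξ ≠ 0) : 0 ≤ wtDual β ξ :=
  div_nonneg symb_nonneg (wt_pos hβ hξ).le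

/-- Each term of the symbol loses one factor to `wt`: `r² ≤ wt` leaves `1`, and `r^{-β} ≤ wt` leaves
`r^{-β}` out of `r^{-2β}`. Outside the unit ball `2π|ξ| ≥ 1`, so only the part near the origin is
singular. -/
theorem wtDual_le (hβ : 0 < β) (hξ : ξ ≠ 0) :
    wtDual β ξ ≤ 2 + (Metric.ball (0 : E n) 1).indicator
      (fun ξ => (2 * Real.pi * ‖ξ‖) ^ (-β)) ξ := by
  have hr := freq_pos hξ
  have h0 := wt_pos hβ hξ
  have h1 : wtDual β ξ ≤ 1 + (2 * Real.pi * ‖ξ‖) ^ (-β) := by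
    unfold wtDual
    rw [symb_eq, div_le_iff₀ h0, add_mul, one_mul]
    refine add_le_add (freq_sq_le_wt hβ hξ) ?_
    rw [sq]
    exact mul_le_mul_of_nonneg_left (freq_rpow_neg_le_wt hβ hξ) (by positivity)
  by_cases h : ξ ∈ Metric.ball (0 : E n) 1
  · rw [indicator_of_mem h]; linarith
  · rw [indicator_of_notMem h]
    have h2 : 1 ≤ ‖ξ‖ := by simpa using h
    have h3 : 1 ≤ 2 * Real.pi * ‖ξ‖ := by nlinarith [Real.pi_gt_three]
    have := Real.rpow_le_one_of_one_le_of_nonpos h3 (neg_nonpos.2 hβ.le)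
    linarith

end pointwise

/-- At the origin `0 ^ (-β)` is `0` in Lean, so `wt` vanishes there and the pointwise bounds fail;
the origin is a null set because `n ≥ 1`. -/
theorem ae_ne_zero {n : ℕ} (hn : 1 ≤ n) : ∀ᵐ ξ : E n, ξ ≠ 0 := by
  have : Nonempty (Fin n) := ⟨⟨0, hn⟩⟩
  have : Nontrivial (E n) := by
    refine ⟨⟨EuclideanSpace.single ⟨0, hn⟩ 1, 0, fun h => ?_⟩⟩
    simpa using congrArg norm h
  exact compl_mem_ae_iff.2 (measure_singleton _)

/-- In polar coordinates the square has radial density `y^{n-1-2β}` up to a constant; its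
integrability at `0` is the condition `β < n/2`. -/
theorem memLp_ball_rpow_neg {n : ℕ} {β : ℝ} (hn : 1 ≤ n) (hβn : β < n / 2) :
    MemLp ((Metric.ball (0 : E n) 1).indicator
      (fun ξ : E n => (2 * Real.pi * ‖ξ‖) ^ (-β))) 2 volume := by
  have : Nontrivial (E n) := by
    refine ⟨⟨EuclideanSpace.single ⟨0, hn⟩ 1, 0, fun h => ?_⟩⟩
    simpa using congrArg norm h
  rw [memLp_indicator_iff_restrict measurableSet_ball,
    memLp_two_iff_integrable_sq (by
      exact Measurable.aestronglyMeasurable (by fun_prop))]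
  have h := (integrableOn_fun_norm_addHaar (μ := (volume : Measure (E n)))
    (f := fun y : ℝ => ((2 * Real.pi * y) ^ (-β)) ^ 2) (r := 1)).2 ?_
  · exact h
  have h1 : IntegrableOn (fun y : ℝ => ((2 * Real.pi) ^ (-β)) ^ 2 * y ^ ((n : ℝ) - 1 - 2 * β))
      (Ioo 0 1) := by
    refine Integrable.const_mul ?_ _
    have := intervalIntegral.intervalIntegrable_rpow' (a := 0) (b := 1)
      (r := (n : ℝ) - 1 - 2 * β) (by linarith)
    rw [intervalIntegrable_iff_integrableOn_Ioo_of_le zero_le_one] at this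
    exact this
  refine h1.congr_fun (fun y hy => ?_) measurableSet_Ioo
  have hy0 : 0 < y := hy.1
  simp only [finrank_euclideanSpace, Fintype.card_fin, smul_eq_mul]
  rw [Real.mul_rpow (by positivity) hy0.le, mul_pow, mul_left_comm]
  congr 1
  rw [← Real.rpow_natCast, ← Real.rpow_natCast, ← Real.rpow_mul hy0.le, ← Real.rpow_add hy0,
    Nat.cast_sub hn]
  congr 1
  push_cast; ring

/-- The inverse square of the weight decays like `|ξ|^{-8}` or faster, which is integrable because
`n ≤ 4 < 8`. -/
theorem memLp_inv_wt {n : ℕ} {β : ℝ} (hn : 1 ≤ n) (hn4 : n ≤ 4) (hβ : 0 < β) :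
    MemLp (fun ξ : E n => (((wt β ξ)⁻¹ : ℝ) : ℂ)) 2 volume := by
  rw [memLp_two_iff_integrable_sq_norm (by fun_prop)]
  have h : Integrable (fun ξ : E n => 16 * (1 + ‖ξ‖) ^ (-(8 : ℝ))) := by
    refine Integrable.const_mul (integrable_one_add_norm ?_) _
    simp only [finrank_euclideanSpace, Fintype.card_fin]
    have : (n : ℝ) ≤ 4 := by exact_mod_cast hn4
    linarith
  refine h.mono' (by fun_prop) ?_
  filter_upwards [ae_ne_zero hn] with ξ hξ
  have h1 := sqrt_pow_four_le_wt hβ hξ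
  have h0 := wt_pos hβ hξ
  have h2 : (1 + ‖ξ‖) ^ 2 / 2 ≤ 1 + (2 * Real.pi * ‖ξ‖) ^ 2 := by
    have h3 : ‖ξ‖ ≤ 2 * Real.pi * ‖ξ‖ := by nlinarith [Real.pi_gt_three, norm_nonneg ξ]
    have := pow_le_pow_left₀ (norm_nonneg ξ) h3 2
    nlinarith [sq_nonneg (1 - ‖ξ‖)]
  have h4 : (1 + ‖ξ‖) ^ 4 / 4 ≤ wt β ξ := by
    refine le_trans ?_ h1
    have := pow_le_pow_left₀ (by positivity) h2 2
    calc _ = ((1 + ‖ξ‖) ^ 2 / 2) ^ 2 := by ring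
      _ ≤ _ := this
  have h5 : (wt β ξ)⁻¹ ≤ 4 * ((1 + ‖ξ‖) ^ 4)⁻¹ := by
    rw [inv_le_comm₀ h0 (by positivity)]
    simpa [mul_inv, div_eq_mul_inv, mul_comm] using h4
  rw [norm_pow, norm_norm, Complex.norm_real, Real.norm_of_nonneg (by positivity),
    Real.rpow_neg (by positivity)]
  calc (wt β ξ)⁻¹ ^ 2 ≤ (4 * ((1 + ‖ξ‖) ^ 4)⁻¹) ^ 2 := by gcongr
    _ = 16 * ((1 + ‖ξ‖) ^ 8)⁻¹ := by rw [mul_pow, inv_pow, ← pow_mul]; norm_num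
    _ = _ := by norm_cast

/-- The functions of `H⁴_β` are bounded. -/
theorem exists_enorm_le_eHs {n : ℕ} {β : ℝ} (hn : 1 ≤ n) (hn4 : n ≤ 4) (hβ : 0 < β) :
    ∃ C : ℝ≥0, ∀ u : L2 n, eHs 4 β u < ∞ → ∀ᵐ x, ‖u x‖ₑ ≤ C * eHs 4 β u := by
  have hw := memLp_inv_wt hn hn4 hβ
  refine ⟨(eLpNorm (fun ξ : E n => (((wt β ξ)⁻¹ : ℝ) : ℂ)) 2 volume).toNNReal, fun u hu => ?_⟩
  rw [ENNReal.coe_toNNReal hw.2.ne]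
  -- Cauchy–Schwarz on `û = wt⁻¹ · (wt û)` bounds `û` in `L¹`, hence `u` in `L^∞`.
  have e : ((𝓕 u : L2 n) : E n → ℂ) =ᵐ[volume]
      (fun ξ : E n => (((wt β ξ)⁻¹ : ℝ) : ℂ)) • (fun ξ => (wt β ξ : ℂ) * (𝓕 u : L2 n) ξ) := by
    filter_upwards [ae_ne_zero hn] with ξ hξ
    have : (wt β ξ : ℂ) ≠ 0 := by exact_mod_cast (wt_pos hβ hξ).ne'
    simp [this]
  have hm : AEStronglyMeasurable (fun ξ => (wt β ξ : ℂ) * (𝓕 u : L2 n) ξ) volume :=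
    AEStronglyMeasurable.mul (by fun_prop) (Lp.aestronglyMeasurable _)
  have h1 : eLpNorm ((𝓕 u : L2 n) : E n → ℂ) 1 volume ≤
      eLpNorm (fun ξ : E n => (((wt β ξ)⁻¹ : ℝ) : ℂ)) 2 volume * eHs 4 β u := by
    rw [eLpNorm_congr_ae e, eHs_four]
    exact eLpNorm_smul_le_mul_eLpNorm hm hw.1
  have h2 : Integrable ((𝓕 u : L2 n) : E n → ℂ) :=
    memLp_one_iff_integrable.1 ⟨Lp.aestronglyMeasurable _,
      h1.trans_lt (ENNReal.mul_lt_top hw.2 hu)⟩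
  filter_upwards [enorm_le_of_fourier_integrable u h2] with x hx
  exact hx.trans h1

theorem eLpNorm_fourier_coe {n : ℕ} (u : L2 n) :
    eLpNorm ((𝓕 u : L2 n) : E n → ℂ) 2 volume = ‖u‖ₑ := by
  rw [← Lp.enorm_def, ← ofReal_norm, ← ofReal_norm, Lp.norm_fourier_eq]

theorem enorm_le_eHs {n : ℕ} {β : ℝ} (hn : 1 ≤ n) (hβ : 0 < β) (u : L2 n) :
    ‖u‖ₑ ≤ eHs 4 β u := by
  rw [← eLpNorm_fourier_coe, eHs_four]
  refine eLpNorm_mono_ae ?_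
  filter_upwards [ae_ne_zero hn] with ξ hξ
  have := one_le_wt hβ hξ
  rw [norm_mul, Complex.norm_real, Real.norm_of_nonneg (by linarith)]
  exact le_mul_of_one_le_left (norm_nonneg _) this

theorem eD_one_le_eHs {n : ℕ} {β : ℝ} (hn : 1 ≤ n) (hβ : 0 < β) (u : L2 n) :
    eD 1 u ≤ eHs 4 β u := by
  rw [eD, eHs_four]
  refine eLpNorm_mono_ae ?_
  filter_upwards [ae_ne_zero hn] with ξ hξ
  have h1 := freq_le_wt hβ hξ
  have h0 := freq_pos hξ
  rw [norm_mul, norm_mul, Complex.norm_real, Complex.norm_real, Real.rpow_one,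
    Real.norm_of_nonneg h0.le, Real.norm_of_nonneg (h0.le.trans h1)]
  gcongr

theorem eD_neg_le_eHs {n : ℕ} {β : ℝ} (hn : 1 ≤ n) (hβ : 0 < β) (u : L2 n) :
    eD (-β) u ≤ eHs 4 β u := by
  rw [eD, eHs_four]
  refine eLpNorm_mono_ae ?_
  filter_upwards [ae_ne_zero hn] with ξ hξ
  have h1 := freq_rpow_neg_le_wt hβ hξ
  have h0 := freq_pos hξ
  rw [norm_mul, norm_mul, Complex.norm_real, Complex.norm_real,
    Real.norm_of_nonneg (by positivity), Real.norm_of_nonneg (wt_pos hβ hξ).le]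
  gcongr

theorem eX_le_eHs {n : ℕ} {β : ℝ} (hn : 1 ≤ n) (hβ : 0 < β) (u : L2 n) :
    eX β u ≤ 2 * eHs 4 β u := by
  have h1 := enorm_le_eHs hn hβ u
  have h2 := eD_one_le_eHs hn hβ u
  have h3 := eD_neg_le_eHs hn hβ u
  have h : ‖u‖ₑ ^ 2 + eD 1 u ^ 2 + eD (-β) u ^ 2 ≤ (2 * eHs 4 β u) ^ (2 : ℝ) := by
    calc _ ≤ eHs 4 β u ^ 2 + eHs 4 β u ^ 2 + eHs 4 β u ^ 2 := by gcongr
      _ = 3 * eHs 4 β u ^ 2 := by ring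
      _ ≤ 4 * eHs 4 β u ^ 2 := by gcongr; norm_num
      _ = _ := by
        rw [ENNReal.rpow_ofNat, mul_pow]; norm_num
  rw [eX]
  calc _ ≤ ((2 * eHs 4 β u) ^ (2 : ℝ)) ^ (1 / 2 : ℝ) := by gcongr
    _ = _ := by rw [← ENNReal.rpow_mul]; norm_num

/-- The dual weight maps Fourier transforms of functions of `L¹ ∩ L²` to `L²`. -/
theorem exists_eLpNorm_wtDual_fourier_le {n : ℕ} {β : ℝ} (hn : 1 ≤ n) (hβ : 0 < β)
    (hβn : β < n / 2) :
    ∃ C : ℝ≥0, ∀ f : E n → ℂ, Integrable f → MemLp f 2 →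
      eLpNorm (fun ξ => (wtDual β ξ : ℂ) * 𝓕 f ξ) 2 volume ≤
        C * eLpNorm f 1 volume + 2 * eLpNorm f 2 volume := by
  have hb := memLp_ball_rpow_neg hn hβn
  set B : E n → ℝ := (Metric.ball (0 : E n) 1).indicator
    (fun ξ : E n => (2 * Real.pi * ‖ξ‖) ^ (-β)) with hB
  have hB0 : ∀ ξ, 0 ≤ B ξ := fun ξ => indicator_nonneg (fun _ _ => by positivity) _
  refine ⟨(eLpNorm B 2 volume).toNNReal, fun f h1 h2 => ?_⟩
  rw [ENNReal.coe_toNNReal hb.2.ne]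
  have hfin : eLpNorm f 1 volume ≠ ∞ := (memLp_one_iff_integrable.2 h1).2.ne
  have hF := memLp_fourier h1 h2
  calc eLpNorm (fun ξ => (wtDual β ξ : ℂ) * 𝓕 f ξ) 2 volume
      ≤ eLpNorm ((fun ξ => (eLpNorm f 1 volume).toReal * B ξ) + fun ξ => 2 * ‖𝓕 f ξ‖) 2 volume := by
        refine eLpNorm_mono_ae ?_
        filter_upwards [ae_ne_zero hn] with ξ hξ
        have h3 := wtDual_le hβ hξ
        have h4 := wtDual_nonneg hβ hξ
        have h5 : ‖𝓕 f ξ‖ ≤ (eLpNorm f 1 volume).toReal := by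
          have := ENNReal.toReal_mono hfin (enorm_fourier_le f ξ)
          simpa using this
        rw [norm_mul, Complex.norm_real, Real.norm_of_nonneg h4, Pi.add_apply,
          Real.norm_of_nonneg (add_nonneg (mul_nonneg (by simp) (hB0 ξ)) (by positivity))]
        -- The singular part `B` lies in `L²` and is paired with the sup bound of `𝓕 f` by the `L¹`
        -- norm; the constant part is left to Plancherel.
        calc wtDual β ξ * ‖𝓕 f ξ‖ ≤ (2 + B ξ) * ‖𝓕 f ξ‖ := by gcongr
          _ = ‖𝓕 f ξ‖ * B ξ + 2 * ‖𝓕 f ξ‖ := by ring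
          _ ≤ _ := by gcongr; exact hB0 ξ
    _ ≤ eLpNorm (fun ξ => (eLpNorm f 1 volume).toReal * B ξ) 2 volume +
        eLpNorm (fun ξ => 2 * ‖𝓕 f ξ‖) 2 volume :=
        eLpNorm_add_le (hb.1.const_mul _) (hF.1.norm.const_mul _) (by norm_num)
    _ = _ := by
        congr 1
        · have := eLpNorm_const_smul (eLpNorm f 1 volume).toReal B 2 (volume : Measure (E n))
          rw [Real.enorm_of_nonneg (by simp), ENNReal.ofReal_toReal hfin, mul_comm] at this
          exact this
        · have := eLpNorm_const_smul (2 : ℝ) (fun ξ => ‖𝓕 f ξ‖) 2 (volume : Measure (E n))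
          rw [eLpNorm_norm, eLpNorm_fourier h1 h2, Real.enorm_of_nonneg (by simp)] at this
          simpa using! this

/-! ### Continuity of the cubic nonlinearity on `H⁴_β`. -/

/-- The nonlinearity `|u|² u`. -/
noncomputable def cubic {n : ℕ} (u : L2 n) : E n → ℂ := fun x => ((‖u x‖ ^ 2 : ℝ) : ℂ) * u x

theorem cubicHat_eq {n : ℕ} (u : L2 n) : cubicHat u = 𝓕 (cubic u) := rfl

theorem fourier_sub_ae {n : ℕ} (u w : L2 n) :
    ((𝓕 (u - w) : L2 n) : E n → ℂ) =ᵐ[volume]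
      fun ξ => (𝓕 u : L2 n) ξ - (𝓕 w : L2 n) ξ := by
  have : (𝓕 (u - w) : L2 n) = 𝓕 u - 𝓕 w := (Lp.fourierTransformₗᵢ (E n) ℂ).map_sub u w
  rw [this]
  exact Lp.coeFn_sub _ _

/-- The triangle inequality for weighted `L²` norms on the Fourier side. -/
theorem eLpNorm_weight_fourier_le_add {n : ℕ} {w : E n → ℝ} (hw : Measurable w) (u v : L2 n) :
    eLpNorm (fun ξ => (w ξ : ℂ) * (𝓕 u : L2 n) ξ) 2 volume ≤
      eLpNorm (fun ξ => (w ξ : ℂ) * (𝓕 (u - v) : L2 n) ξ) 2 volume +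
        eLpNorm (fun ξ => (w ξ : ℂ) * (𝓕 v : L2 n) ξ) 2 volume := by
  have hm : ∀ u : L2 n, AEStronglyMeasurable (fun ξ => (w ξ : ℂ) * (𝓕 u : L2 n) ξ) volume :=
    fun u => AEStronglyMeasurable.mul (by fun_prop) (Lp.aestronglyMeasurable _)
  refine le_trans (le_of_eq (eLpNorm_congr_ae ?_)) (eLpNorm_add_le (hm (u - v)) (hm v) (by norm_num))
  filter_upwards [fourier_sub_ae u v] with ξ hξ
  rw [Pi.add_apply, hξ]
  ring

theorem eHs_le_add {n : ℕ} (s β : ℝ) (u v : L2 n) : eHs s β u ≤ eHs s β (u - v) + eHs s β v :=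
  eLpNorm_weight_fourier_le_add (by fun_prop) u v

theorem norm_cubic_sub_le (a b : ℂ) :
    ‖((‖a‖ ^ 2 : ℝ) : ℂ) * a - ((‖b‖ ^ 2 : ℝ) : ℂ) * b‖ ≤ (‖a‖ + ‖b‖) ^ 2 * ‖a - b‖ := by
  have e : ((‖a‖ ^ 2 : ℝ) : ℂ) * a - ((‖b‖ ^ 2 : ℝ) : ℂ) * b =
      ((‖a‖ ^ 2 : ℝ) : ℂ) * (a - b) + (((‖a‖ - ‖b‖) * (‖a‖ + ‖b‖) : ℝ) : ℂ) * b := by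
    push_cast; ring
  have h := abs_norm_sub_norm_le a b
  rw [e]
  refine (norm_add_le _ _).trans ?_
  rw [norm_mul, norm_mul, Complex.norm_real, Complex.norm_real, norm_mul, Real.norm_eq_abs,
    Real.norm_eq_abs, Real.norm_eq_abs, abs_of_nonneg (by positivity : (0 : ℝ) ≤ ‖a‖ ^ 2),
    abs_of_nonneg (by positivity : (0 : ℝ) ≤ ‖a‖ + ‖b‖)]
  have ha := norm_nonneg a
  have hb := norm_nonneg b
  have hd := norm_nonneg (a - b)
  have h1 : |‖a‖ - ‖b‖| * (‖a‖ + ‖b‖) * ‖b‖ ≤ ‖a - b‖ * (‖a‖ + ‖b‖) * ‖b‖ := by gcongr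
  nlinarith [mul_nonneg (mul_nonneg ha hb) hd]

section bounds

variable {n : ℕ} {M : ℝ} {u w : L2 n}

theorem aestronglyMeasurable_cubic (u : L2 n) : AEStronglyMeasurable (cubic u) volume := by
  have h := Lp.aestronglyMeasurable u
  exact (Complex.continuous_ofReal.comp_aestronglyMeasurable (h.norm.pow 2)).mul h

theorem memLp_cubic (hu : ∀ᵐ x, ‖u x‖ ≤ M) : MemLp (cubic u) 2 volume := by
  refine MemLp.mono (g := fun x => M ^ 2 * ‖u x‖) ((Lp.memLp u).norm.const_mul _)
    (aestronglyMeasurable_cubic u) ?_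
  filter_upwards [hu] with x hx
  rw [cubic, norm_mul, Complex.norm_real, Real.norm_of_nonneg (by positivity),
    Real.norm_of_nonneg (by positivity)]
  gcongr

theorem integrable_cubic (hu : ∀ᵐ x, ‖u x‖ ≤ M) : Integrable (cubic u) := by
  have h : Integrable (fun x => M * ‖u x‖ ^ 2) :=
    ((memLp_two_iff_integrable_sq_norm (Lp.aestronglyMeasurable u)).1 (Lp.memLp u)).const_mul _
  refine h.mono' (aestronglyMeasurable_cubic u) ?_
  filter_upwards [hu] with x hx
  rw [cubic, norm_mul, Complex.norm_real, Real.norm_of_nonneg (by positivity), mul_comm]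
  gcongr

theorem eLpNorm_two_cubic_sub_le (hu : ∀ᵐ x, ‖u x‖ ≤ M) (hw : ∀ᵐ x, ‖w x‖ ≤ M) :
    eLpNorm (fun x => cubic u x - cubic w x) 2 volume ≤
      ENNReal.ofReal ((2 * M) ^ 2) * ‖u - w‖ₑ := by
  rw [Lp.enorm_def]
  refine eLpNorm_le_mul_eLpNorm_of_ae_le_mul ?_ 2
  filter_upwards [hu, hw, Lp.coeFn_sub u w] with x h1 h2 h3
  rw [h3, Pi.sub_apply]
  refine (norm_cubic_sub_le _ _).trans ?_
  gcongr
  linarith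

/-- One factor `|u| + |w|` is bounded by `2M`; the other is paired with `u - w` by Cauchy–Schwarz.
-/
theorem eLpNorm_one_cubic_sub_le (hu : ∀ᵐ x, ‖u x‖ ≤ M) (hw : ∀ᵐ x, ‖w x‖ ≤ M) :
    eLpNorm (fun x => cubic u x - cubic w x) 1 volume ≤
      ENNReal.ofReal (2 * M) * ((‖u‖ₑ + ‖w‖ₑ) * ‖u - w‖ₑ) := by
  have hum := (Lp.aestronglyMeasurable u).norm
  have hwm := (Lp.aestronglyMeasurable w).norm
  have h1 : eLpNorm (fun x => cubic u x - cubic w x) 1 volume ≤ ENNReal.ofReal (2 * M) *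
      eLpNorm ((fun x => ‖u x‖ + ‖w x‖) • (fun x => ‖(u - w : L2 n) x‖)) 1 volume := by
    refine eLpNorm_le_mul_eLpNorm_of_ae_le_mul ?_ 1
    filter_upwards [hu, hw, Lp.coeFn_sub u w] with x h1 h2 h3
    rw [Pi.smul_apply', h3, Pi.sub_apply, smul_eq_mul, Real.norm_of_nonneg (by positivity),
      ← mul_assoc]
    refine (norm_cubic_sub_le _ _).trans ?_
    rw [sq]
    gcongr
    linarith
  refine h1.trans ?_
  gcongr
  refine (eLpNorm_smul_le_mul_eLpNorm (p := 2) (q := 2) (r := 1)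
    (Lp.aestronglyMeasurable _).norm (hum.add hwm)).trans ?_
  rw [eLpNorm_norm, ← Lp.enorm_def]
  gcongr
  refine (eLpNorm_add_le hum hwm (by norm_num)).trans ?_
  rw [eLpNorm_norm, eLpNorm_norm, ← Lp.enorm_def, ← Lp.enorm_def]

end bounds

section tendsto

variable {n : ℕ} {β : ℝ} {ι : Type*} {l : Filter ι} {u : ι → L2 n} {w : L2 n}

theorem exists_norm_le {n : ℕ} {β : ℝ} (hn : 1 ≤ n) (hn4 : n ≤ 4) (hβ : 0 < β) {u : L2 n}
    (hu : eHs 4 β u < ∞) : ∃ M : ℝ, ∀ᵐ x, ‖u x‖ ≤ M := by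
  obtain ⟨C, hC⟩ := exists_enorm_le_eHs hn hn4 hβ
  refine ⟨(C * eHs 4 β u).toReal, ?_⟩
  filter_upwards [hC u hu] with x hx
  simpa using ENNReal.toReal_mono (ENNReal.mul_lt_top ENNReal.coe_lt_top hu).ne hx

/-- Convergence in `H⁴_β` implies a uniform bound in `L^∞`. -/
theorem exists_eventually_norm_le (hn : 1 ≤ n) (hn4 : n ≤ 4) (hβ : 0 < β)
    (hw : eHs 4 β w < ∞) (h : Tendsto (fun i => eHs 4 β (u i - w)) l (𝓝 0)) :
    ∃ M : ℝ, 0 ≤ M ∧ (∀ᵐ x, ‖w x‖ ≤ M) ∧ ∀ᶠ i in l, ∀ᵐ x, ‖u i x‖ ≤ M := by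
  obtain ⟨C, hC⟩ := exists_enorm_le_eHs hn hn4 hβ
  have hfin : C * (1 + eHs 4 β w) ≠ ∞ :=
    (ENNReal.mul_lt_top ENNReal.coe_lt_top (ENNReal.add_lt_top.2 ⟨ENNReal.one_lt_top, hw⟩)).ne
  refine ⟨(C * (1 + eHs 4 β w)).toReal, ENNReal.toReal_nonneg, ?_, ?_⟩
  · filter_upwards [hC w hw] with x hx
    have : ‖w x‖ₑ ≤ C * (1 + eHs 4 β w) := hx.trans (by gcongr; exact le_add_self)
    simpa using ENNReal.toReal_mono hfin this
  · filter_upwards [h.eventually (eventually_le_nhds one_pos)] with i hi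
    have h1 : eHs 4 β (u i) ≤ 1 + eHs 4 β w := (eHs_le_add _ _ _ w).trans (by gcongr)
    filter_upwards [hC (u i) (h1.trans_lt (ENNReal.add_lt_top.2 ⟨ENNReal.one_lt_top, hw⟩))]
      with x hx
    have : ‖u i x‖ₑ ≤ C * (1 + eHs 4 β w) := hx.trans (by gcongr)
    simpa using ENNReal.toReal_mono hfin this

theorem tendsto_enorm_sub (hn : 1 ≤ n) (hβ : 0 < β)
    (h : Tendsto (fun i => eHs 4 β (u i - w)) l (𝓝 0)) :
    Tendsto (fun i => ‖u i - w‖ₑ) l (𝓝 0) :=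
  tendsto_of_tendsto_of_tendsto_of_le_of_le tendsto_const_nhds h (fun _ => zero_le)
    fun _ => enorm_le_eHs hn hβ _

theorem tendsto_eLpNorm_two_cubic_sub (hn : 1 ≤ n) (hn4 : n ≤ 4) (hβ : 0 < β)
    (hw : eHs 4 β w < ∞) (h : Tendsto (fun i => eHs 4 β (u i - w)) l (𝓝 0)) :
    Tendsto (fun i => eLpNorm (fun x => cubic (u i) x - cubic w x) 2 volume) l (𝓝 0) := by
  obtain ⟨M, -, hM, hMu⟩ := exists_eventually_norm_le hn hn4 hβ hw h
  have h1 := ENNReal.Tendsto.const_mul (a := ENNReal.ofReal ((2 * M) ^ 2))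
    (tendsto_enorm_sub hn hβ h) (Or.inr ENNReal.ofReal_ne_top)
  rw [mul_zero] at h1
  refine tendsto_of_tendsto_of_tendsto_of_le_of_le' tendsto_const_nhds h1
    (Eventually.of_forall fun _ => zero_le) ?_
  filter_upwards [hMu] with i hi using eLpNorm_two_cubic_sub_le hi hM

theorem tendsto_eLpNorm_one_cubic_sub (hn : 1 ≤ n) (hn4 : n ≤ 4) (hβ : 0 < β)
    (hw : eHs 4 β w < ∞) (h : Tendsto (fun i => eHs 4 β (u i - w)) l (𝓝 0)) :
    Tendsto (fun i => eLpNorm (fun x => cubic (u i) x - cubic w x) 1 volume) l (𝓝 0) := by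
  obtain ⟨M, -, hM, hMu⟩ := exists_eventually_norm_le hn hn4 hβ hw h
  have h0 := tendsto_enorm_sub hn hβ h
  have h1 := ENNReal.Tendsto.const_mul (a := ENNReal.ofReal (2 * M) * (1 + ‖w‖ₑ + ‖w‖ₑ))
    h0 (Or.inr (ENNReal.mul_ne_top ENNReal.ofReal_ne_top (by simp)))
  rw [mul_zero] at h1
  refine tendsto_of_tendsto_of_tendsto_of_le_of_le' tendsto_const_nhds h1
    (Eventually.of_forall fun _ => zero_le) ?_
  filter_upwards [hMu, h0.eventually (eventually_le_nhds one_pos)] with i hi hi1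
  refine (eLpNorm_one_cubic_sub_le hi hM).trans ?_
  rw [← mul_assoc]
  gcongr
  calc ‖u i‖ₑ = ‖u i - w + w‖ₑ := by rw [sub_add_cancel]
    _ ≤ ‖u i - w‖ₑ + ‖w‖ₑ := enorm_add_le _ _
    _ ≤ _ := by gcongr

theorem cubicHat_sub {v w : L2 n} (hv : Integrable (cubic v)) (hw : Integrable (cubic w)) (ξ : E n) :
    cubicHat v ξ - cubicHat w ξ = 𝓕 (fun x => cubic v x - cubic w x) ξ := by
  rw [fourier_sub_of_integrable hv hw, cubicHat_eq, cubicHat_eq]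

/-- Convergence at every single frequency is needed because Duhamel's integral is taken in time at
fixed `ξ`. It comes from `L¹` convergence of the nonlinearity. -/
theorem tendsto_cubicHat (hn : 1 ≤ n) (hn4 : n ≤ 4) (hβ : 0 < β)
    (hw : eHs 4 β w < ∞) (h : Tendsto (fun i => eHs 4 β (u i - w)) l (𝓝 0)) (ξ : E n) :
    Tendsto (fun i => cubicHat (u i) ξ) l (𝓝 (cubicHat w ξ)) := by
  obtain ⟨M, -, hM, hMu⟩ := exists_eventually_norm_le hn hn4 hβ hw h
  rw [tendsto_iff_edist_tendsto_0]
  refine tendsto_of_tendsto_of_tendsto_of_le_of_le' tendsto_const_nhds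
    (tendsto_eLpNorm_one_cubic_sub hn hn4 hβ hw h) (Eventually.of_forall fun _ => zero_le) ?_
  filter_upwards [hMu] with i hi
  rw [edist_eq_enorm_sub, cubicHat_sub (integrable_cubic hi) (integrable_cubic hM)]
  exact enorm_fourier_le _ _

theorem tendsto_eLpNorm_cubicHat_sub (hn : 1 ≤ n) (hn4 : n ≤ 4) (hβ : 0 < β)
    (hw : eHs 4 β w < ∞) (h : Tendsto (fun i => eHs 4 β (u i - w)) l (𝓝 0)) :
    Tendsto (fun i => eLpNorm (fun ξ => cubicHat (u i) ξ - cubicHat w ξ) 2 volume) l (𝓝 0) := by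
  obtain ⟨M, -, hM, hMu⟩ := exists_eventually_norm_le hn hn4 hβ hw h
  refine (tendsto_eLpNorm_two_cubic_sub hn hn4 hβ hw h).congr' ?_
  filter_upwards [hMu] with i hi
  simp only [cubicHat_sub (integrable_cubic hi) (integrable_cubic hM)]
  exact (eLpNorm_fourier ((integrable_cubic hi).sub (integrable_cubic hM))
    ((memLp_cubic hi).sub (memLp_cubic hM))).symm

theorem tendsto_eLpNorm_wtDual_cubicHat_sub (hn : 1 ≤ n) (hn4 : n ≤ 4) (hβ : 0 < β)
    (hβn : β < n / 2)
    (hw : eHs 4 β w < ∞) (h : Tendsto (fun i => eHs 4 β (u i - w)) l (𝓝 0)) :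
    Tendsto (fun i => eLpNorm (fun ξ => (wtDual β ξ : ℂ) * (cubicHat (u i) ξ - cubicHat w ξ))
      2 volume) l (𝓝 0) := by
  obtain ⟨M, -, hM, hMu⟩ := exists_eventually_norm_le hn hn4 hβ hw h
  obtain ⟨C, hC⟩ := exists_eLpNorm_wtDual_fourier_le hn hβ hβn
  have h1 := (ENNReal.Tendsto.const_mul (a := (C : ℝ≥0∞))
    (tendsto_eLpNorm_one_cubic_sub hn hn4 hβ hw h) (Or.inr ENNReal.coe_ne_top)).add
    (ENNReal.Tendsto.const_mul (a := 2)
    (tendsto_eLpNorm_two_cubic_sub hn hn4 hβ hw h) (Or.inr (by norm_num)))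
  rw [mul_zero, mul_zero, add_zero] at h1
  refine tendsto_of_tendsto_of_tendsto_of_le_of_le' tendsto_const_nhds h1
    (Eventually.of_forall fun _ => zero_le) ?_
  filter_upwards [hMu] with i hi
  simp only [cubicHat_sub (integrable_cubic hi) (integrable_cubic hM)]
  exact hC _ ((integrable_cubic hi).sub (integrable_cubic hM))
    ((memLp_cubic hi).sub (memLp_cubic hM))

theorem continuous_cubicHat (hn : 1 ≤ n) (hn4 : n ≤ 4) (hβ : 0 < β) (hw : eHs 4 β w < ∞) :
    Continuous (cubicHat w) := by
  obtain ⟨M, hM⟩ := exists_norm_le hn hn4 hβ hw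
  exact continuous_fourier_of_integrable (integrable_cubic hM)

theorem memLp_cubicHat (hn : 1 ≤ n) (hn4 : n ≤ 4) (hβ : 0 < β) (hw : eHs 4 β w < ∞) :
    MemLp (cubicHat w) 2 volume := by
  obtain ⟨M, hM⟩ := exists_norm_le hn hn4 hβ hw
  exact memLp_fourier (integrable_cubic hM) (memLp_cubic hM)

theorem memLp_wtDual_cubicHat (hn : 1 ≤ n) (hn4 : n ≤ 4) (hβ : 0 < β) (hβn : β < n / 2)
    (hw : eHs 4 β w < ∞) :
    MemLp (fun ξ => (wtDual β ξ : ℂ) * cubicHat w ξ) 2 volume := by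
  obtain ⟨M, hM⟩ := exists_norm_le hn hn4 hβ hw
  obtain ⟨C, hC⟩ := exists_eLpNorm_wtDual_fourier_le hn hβ hβn
  have hc := continuous_cubicHat hn hn4 hβ hw
  refine ⟨(Measurable.aestronglyMeasurable (by fun_prop)).mul hc.aestronglyMeasurable,
    (hC _ (integrable_cubic hM) (memLp_cubic hM)).trans_lt ?_⟩
  exact ENNReal.add_lt_top.2 ⟨ENNReal.mul_lt_top ENNReal.coe_lt_top
    (memLp_one_iff_integrable.2 (integrable_cubic hM)).2,
    ENNReal.mul_lt_top (by norm_num) (memLp_cubic hM).2⟩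

end tendsto

/-! ### Convergence of products, pairings and time averages in `L²`. -/

section general

variable {α : Type*} [MeasurableSpace α] {μ : Measure α}

theorem eLpNorm_two_sq (f : α → ℂ) : eLpNorm f 2 μ ^ 2 = ∫⁻ x, ‖f x‖ₑ ^ 2 ∂μ := by
  have := eLpNorm_nnreal_pow_eq_lintegral (μ := μ) (f := f) (p := 2) (by norm_num)
  simp only [NNReal.coe_ofNat, ENNReal.coe_ofNat, ENNReal.rpow_ofNat] at this
  exact this

theorem tendsto_eLpNorm_two_iff {ι : Type*} {l : Filter ι} {f : ι → α → ℂ} :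
    Tendsto (fun i => eLpNorm (f i) 2 μ) l (𝓝 0) ↔
      Tendsto (fun i => ∫⁻ x, ‖f i x‖ₑ ^ 2 ∂μ) l (𝓝 0) := by
  simp only [← eLpNorm_two_sq]
  constructor
  · intro h
    have := (ENNReal.continuous_pow 2).tendsto 0 |>.comp h
    simpa using! this
  · intro h
    have := (ENNReal.continuous_rpow_const (y := 1 / 2)).tendsto 0 |>.comp h
    rw [ENNReal.zero_rpow_of_pos (by norm_num)] at this
    refine this.congr fun i => ?_
    rw [Function.comp, ← ENNReal.rpow_natCast, ← ENNReal.rpow_mul]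
    norm_num

/-- Multiplying a fixed `L²` function by bounded multipliers that tend to zero pointwise. -/
theorem tendsto_eLpNorm_mul_of_bounded {ι : Type*} {l : Filter ι} [l.IsCountablyGenerated]
    {φ : ι → α → ℂ} {f : α → ℂ} (hf : MemLp f 2 μ) (C : ℝ)
    (hm : ∀ᶠ i in l, AEStronglyMeasurable (φ i) μ)
    (hb : ∀ᶠ i in l, ∀ᵐ x ∂μ, ‖φ i x‖ ≤ C)
    (hφ : ∀ᵐ x ∂μ, Tendsto (fun i => φ i x) l (𝓝 0)) :
    Tendsto (fun i => eLpNorm (fun x => φ i x * f x) 2 μ) l (𝓝 0) := by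
  have h1 : Tendsto (fun i => ∫ x, ‖φ i x * f x‖ ^ 2 ∂μ) l (𝓝 (∫ _, (0 : ℝ) ∂μ)) := by
    refine tendsto_integral_filter_of_dominated_convergence (fun x => C ^ 2 * ‖f x‖ ^ 2) ?_ ?_ ?_ ?_
    · filter_upwards [hm] with i hi using (hi.mul hf.1).norm.pow 2
    · filter_upwards [hb] with i hi
      filter_upwards [hi] with x hx
      rw [norm_mul, Real.norm_of_nonneg (by positivity), mul_pow]
      gcongr
    · exact ((memLp_two_iff_integrable_sq_norm hf.1).1 hf).const_mul _
    · filter_upwards [hφ] with x hx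
      have := ((hx.mul_const (f x)).norm).pow 2
      simpa using this
  rw [integral_zero] at h1
  rw [tendsto_eLpNorm_two_iff]
  have h2 := ENNReal.tendsto_ofReal h1
  rw [ENNReal.ofReal_zero] at h2
  refine h2.congr' ?_
  filter_upwards [hm, hb] with i hi hbi
  rw [ofReal_integral_eq_lintegral_ofReal]
  · refine lintegral_congr fun x => ?_
    rw [ENNReal.ofReal_pow (norm_nonneg _), ofReal_norm]
  · refine (memLp_two_iff_integrable_sq_norm (hi.mul hf.1)).1
      (MemLp.mono (g := fun x => C * ‖f x‖) (hf.norm.const_mul C) (hi.mul hf.1) ?_)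
    filter_upwards [hbi] with x hx
    simp only [Pi.mul_apply, norm_mul, norm_norm]
    gcongr
    exact hx.trans (le_abs_self C)
  · exact Eventually.of_forall fun x => by positivity

/-- Sesquilinear pairings are continuous in `L²`. -/
theorem tendsto_integral_conj_mul {ι : Type*} {l : Filter ι} {f g : ι → α → ℂ} {f₀ g₀ : α → ℂ}
    (hf : ∀ᶠ i in l, MemLp (f i) 2 μ) (hg : ∀ᶠ i in l, MemLp (g i) 2 μ)
    (hf₀ : MemLp f₀ 2 μ) (hg₀ : MemLp g₀ 2 μ)
    (hfl : Tendsto (fun i => eLpNorm (fun x => f i x - f₀ x) 2 μ) l (𝓝 0))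
    (hgl : Tendsto (fun i => eLpNorm (fun x => g i x - g₀ x) 2 μ) l (𝓝 0)) :
    Tendsto (fun i => ∫ x, (starRingEnd ℂ) (f i x) * g i x ∂μ) l
      (𝓝 (∫ x, (starRingEnd ℂ) (f₀ x) * g₀ x ∂μ)) := by
  classical
  have key : ∀ {f g : α → ℂ} (hf : MemLp f 2 μ) (hg : MemLp g 2 μ),
      ∫ x, (starRingEnd ℂ) (f x) * g x ∂μ = inner ℂ (hf.toLp f) (hg.toLp g) := by
    intro f g hf hg
    rw [L2.inner_def]
    refine integral_congr_ae ?_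
    filter_upwards [hf.coeFn_toLp, hg.coeFn_toLp] with x h1 h2
    rw [h1, h2, RCLike.inner_apply, mul_comm]
  have conv : ∀ {f : ι → α → ℂ} {f₀ : α → ℂ} (hf : ∀ᶠ i in l, MemLp (f i) 2 μ)
      (hf₀ : MemLp f₀ 2 μ)
      (_ : Tendsto (fun i => eLpNorm (fun x => f i x - f₀ x) 2 μ) l (𝓝 0)),
      Tendsto (fun i => if h : MemLp (f i) 2 μ then h.toLp (f i) else 0) l
        (𝓝 (hf₀.toLp f₀)) := by
    intro f f₀ hf hf₀ hl
    rw [tendsto_iff_edist_tendsto_0]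
    refine hl.congr' ?_
    filter_upwards [hf] with i hi
    rw [dif_pos hi, Lp.edist_toLp_toLp]
    rfl
  rw [key hf₀ hg₀]
  refine ((conv hf hf₀ hfl).inner (conv hg hg₀ hgl)).congr' ?_
  filter_upwards [hf, hg] with i h1 h2
  rw [dif_pos h1, dif_pos h2, key h1 h2]

/-- Time averages of a family that tends to zero in `L²` tend to zero in `L²`. -/
theorem tendsto_eLpNorm_average [SFinite μ] {s T : ℝ} (hsT : s < T) {D : ℝ → α → ℂ}
    (hD : AEStronglyMeasurable (Function.uncurry D) ((volume.restrict (Ioc s T)).prod μ))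
    (h : Tendsto (fun r => eLpNorm (D r) 2 μ) (𝓝[>] s) (𝓝 0)) :
    Tendsto (fun t => eLpNorm (fun x => ((t - s : ℝ) : ℂ)⁻¹ * ∫ r in s..t, D r x) 2 μ)
      (𝓝[>] s) (𝓝 0) := by
  rw [tendsto_eLpNorm_two_iff] at h ⊢
  rw [ENNReal.tendsto_nhds_zero] at h ⊢
  intro ε hε
  have h1 := h ε hε
  rw [eventually_nhdsWithin_iff, Metric.eventually_nhds_iff] at h1
  obtain ⟨δ, hδ, hδ1⟩ := h1
  have hmem : Ioo s (min T (s + δ)) ∈ 𝓝[>] s :=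
    Ioo_mem_nhdsGT (lt_min hsT (by linarith))
  filter_upwards [hmem] with t ht
  have hst : s < t := ht.1
  have htT : t < T := ht.2.trans_le (min_le_left _ _)
  have htδ : t < s + δ := ht.2.trans_le (min_le_right _ _)
  have hpos : 0 < t - s := by linarith
  have hD' : AEStronglyMeasurable (Function.uncurry D) ((volume.restrict (Ioc s t)).prod μ) :=
    hD.mono_measure (Measure.prod_mono (Measure.restrict_mono (Ioc_subset_Ioc_right htT.le) le_rfl) le_rfl)
  have hsw : AEStronglyMeasurable (fun p : α × ℝ => D p.2 p.1)
      (μ.prod (volume.restrict (Ioc s t))) := hD'.prod_swap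
  set c : ℝ≥0∞ := ENNReal.ofReal (t - s) with hc
  have hc0 : c ≠ 0 := by simpa [hc] using hpos
  have hct : c ≠ ∞ := ENNReal.ofReal_ne_top
  -- Cauchy–Schwarz in time at fixed `x`: the square of a mean is at most the mean of the squares.
  -- Tonelli then reduces the claim to the smallness of the `L²` norms at single times.
  have hcs : ∀ᵐ x ∂μ, ‖((t - s : ℝ) : ℂ)⁻¹ * ∫ r in s..t, D r x‖ₑ ^ 2 ≤
      c⁻¹ * ∫⁻ r in Ioc s t, ‖D r x‖ₑ ^ 2 := by
    filter_upwards [hsw.prodMk_left] with x hx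
    have e1 : ‖((t - s : ℝ) : ℂ)⁻¹‖ₑ = c⁻¹ := by
      rw [enorm_inv (by exact_mod_cast hpos.ne'), ← ofReal_norm, Complex.norm_real,
        Real.norm_of_nonneg hpos.le]
    have e2 : ‖∫ r in s..t, D r x‖ₑ ≤ eLpNorm (fun r => D r x) 1 (volume.restrict (Ioc s t)) := by
      rw [intervalIntegral.integral_of_le hst.le, eLpNorm_one_eq_lintegral_enorm]
      exact enorm_integral_le_lintegral_enorm _
    have e3 := eLpNorm_le_eLpNorm_mul_rpow_measure_univ (p := 1) (q := 2)
      (μ := volume.restrict (Ioc s t)) (by norm_num) hx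
    rw [Measure.restrict_apply_univ, Real.volume_Ioc, ← hc] at e3
    rw [enorm_mul, e1]
    calc (c⁻¹ * ‖∫ r in s..t, D r x‖ₑ) ^ 2
        ≤ (c⁻¹ * (eLpNorm (fun r => D r x) 2 (volume.restrict (Ioc s t)) *
            c ^ (1 / (1 : ℝ≥0∞).toReal - 1 / (2 : ℝ≥0∞).toReal))) ^ 2 := by
          gcongr; exact e2.trans e3
      _ = c⁻¹ * (c⁻¹ * (c ^ (1 / 2 : ℝ)) ^ 2) *
            eLpNorm (fun r => D r x) 2 (volume.restrict (Ioc s t)) ^ 2 := by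
          norm_num; ring
      _ = _ := by
          rw [eLpNorm_two_sq, ← ENNReal.rpow_natCast, ← ENNReal.rpow_mul]
          norm_num
          rw [ENNReal.inv_mul_cancel hc0 hct, mul_one]
  calc ∫⁻ x, ‖((t - s : ℝ) : ℂ)⁻¹ * ∫ r in s..t, D r x‖ₑ ^ 2 ∂μ
      ≤ ∫⁻ x, (c⁻¹ * ∫⁻ r in Ioc s t, ‖D r x‖ₑ ^ 2) ∂μ := lintegral_mono_ae hcs
    _ = c⁻¹ * ∫⁻ x, (∫⁻ r in Ioc s t, ‖D r x‖ₑ ^ 2) ∂μ :=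
        lintegral_const_mul' _ _ (ENNReal.inv_ne_top.2 hc0)
    _ = c⁻¹ * ∫⁻ r in Ioc s t, (∫⁻ x, ‖D r x‖ₑ ^ 2 ∂μ) := by
        rw [lintegral_lintegral_swap]
        exact hsw.enorm.pow_const 2
    _ ≤ c⁻¹ * ∫⁻ r in Ioc s t, ε := by
        gcongr c⁻¹ * ?_
        refine setLIntegral_mono' measurableSet_Ioc fun r hr => ?_
        refine hδ1 ?_ hr.1
        rw [Real.dist_eq, abs_of_pos (by linarith [hr.1])]
        linarith [hr.2]
    _ = ε := by
        rw [setLIntegral_const, Real.volume_Ioc, ← hc, mul_comm ε, ← mul_assoc,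
          ENNReal.inv_mul_cancel hc0 hct, one_mul]

end general

/-! ### The linear group, the interaction picture and the mean force. -/

/-- The multiplier of the linear group `e^{iτ(-Δ+L_β)}`. -/
noncomputable def phase {n : ℕ} (β τ : ℝ) (ξ : E n) : ℂ := Complex.exp (Complex.I * (τ * symb β ξ : ℝ))

section phase

variable {n : ℕ} {β : ℝ}

@[fun_prop]
theorem measurable_phase (τ : ℝ) : Measurable (phase (n := n) β τ) := by
  unfold phase; fun_prop

theorem norm_phase (τ : ℝ) (ξ : E n) : ‖phase β τ ξ‖ = 1 := by
  rw [phase, mul_comm, Complex.norm_exp_ofReal_mul_I]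

theorem phase_add (τ σ : ℝ) (ξ : E n) : phase β (τ + σ) ξ = phase β τ ξ * phase β σ ξ := by
  rw [phase, phase, phase, ← Complex.exp_add]
  congr 1; push_cast; ring

theorem phase_zero (ξ : E n) : phase β 0 ξ = 1 := by simp [phase]

theorem phase_neg_mul (τ : ℝ) (ξ : E n) : phase β (-τ) ξ * phase β τ ξ = 1 := by
  rw [← phase_add, neg_add_cancel, phase_zero]

theorem continuous_phase_time (ξ : E n) : Continuous (fun τ => phase β τ ξ) := by
  unfold phase; fun_prop

theorem norm_phase_sub_one_le (τ : ℝ) (ξ : E n) : ‖phase β τ ξ - 1‖ ≤ |τ| * symb β ξ := by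
  have := Real.norm_exp_I_mul_ofReal_sub_one_le (x := τ * symb β ξ)
  rwa [Real.norm_eq_abs, abs_mul, abs_of_nonneg symb_nonneg] at this

theorem norm_phase_sub_one_le_two (τ : ℝ) (ξ : E n) : ‖phase β τ ξ - 1‖ ≤ 2 := by
  refine (norm_sub_le _ _).trans ?_
  rw [norm_phase]; norm_num

/-- The geometric mean of the bounds `2` and `|τ| symb`. It costs half a power of the symbol, which
`wt` controls, and yields increments of size `√τ`. -/
theorem norm_phase_sub_one_sq_le (τ : ℝ) (ξ : E n) :
    ‖phase β τ ξ - 1‖ ^ 2 ≤ 2 * (|τ| * symb β ξ) := by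
  rw [sq]
  exact mul_le_mul (norm_phase_sub_one_le_two _ _) (norm_phase_sub_one_le _ _)
    (norm_nonneg _) (by norm_num)

theorem tendsto_phase_sub {s : ℝ} (ξ : E n) :
    Tendsto (fun t => phase β (t - s) ξ - 1) (𝓝[>] s) (𝓝 0) := by
  have h : Continuous (fun t => phase β (t - s) ξ - 1) :=
    ((continuous_phase_time ξ).comp (continuous_id.sub continuous_const)).sub continuous_const
  have := h.tendsto s
  simp only [sub_self, phase_zero] at this
  exact this.mono_left nhdsWithin_le_nhds

end phase

/-- The nonlinear part of the increment of a solution between `s` and `t` (as a mean value). -/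
noncomputable def meanForce {n : ℕ} (β : ℝ) (v : ℝ → L2 n) (s t : ℝ) (ξ : E n) : ℂ :=
  ((t - s : ℝ) : ℂ)⁻¹ * ∫ r in s..t, phase β (r - s) ξ * cubicHat (v r) ξ

section smooth

variable {n : ℕ} {β T : ℝ} {v : ℝ → L2 n} {s : ℝ}

theorem nhdsGT_le_nhdsWithin_Icc (hs : s ∈ Ico 0 T) : 𝓝[>] s ≤ 𝓝[Icc 0 T] s := by
  have h : Ioc s T ∈ 𝓝[>] s := Ioc_mem_nhdsGT hs.2
  rw [← nhdsWithin_inter_of_mem h]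
  exact nhdsWithin_mono _ fun t ht => ⟨hs.1.trans ht.1.1.le, ht.1.2⟩

theorem IsSmoothSolution.tendsto_nhdsGT (hv : IsSmoothSolution β T v) (hs : s ∈ Ico 0 T) :
    Tendsto (fun t => eHs 4 β (v t - v s)) (𝓝[>] s) (𝓝 0) :=
  (hv.cont 4 s ⟨hs.1, hs.2.le⟩).mono_left (nhdsGT_le_nhdsWithin_Icc hs)

theorem IsSmoothSolution.continuousOn_cubicHat (hn : 1 ≤ n) (hn4 : n ≤ 4) (hβ : 0 < β)
    (hv : IsSmoothSolution β T v) (ξ : E n) :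
    ContinuousOn (fun r => cubicHat (v r) ξ) (Icc 0 T) := fun r hr =>
  tendsto_cubicHat hn hn4 hβ (hv.mem 4 r hr) (hv.cont 4 r hr) ξ

theorem IsSmoothSolution.intervalIntegrable (hn : 1 ≤ n) (hn4 : n ≤ 4) (hβ : 0 < β)
    (hv : IsSmoothSolution β T v) (ξ : E n) {a b : ℝ} (c : ℝ) (ha : a ∈ Icc 0 T) (hb : b ∈ Icc 0 T) :
    IntervalIntegrable (fun r => phase β (r - c) ξ * cubicHat (v r) ξ) volume a b := by
  refine ContinuousOn.intervalIntegrable ?_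
  refine ContinuousOn.mul (Continuous.continuousOn ?_)
    ((hv.continuousOn_cubicHat hn hn4 hβ ξ).mono (uIcc_subset_Icc ha hb))
  exact (continuous_phase_time ξ).comp (continuous_id.sub continuous_const)

/-- Duhamel's formula between two times, in the interaction picture. -/
theorem IsSmoothSolution.phase_mul_fourier (hn : 1 ≤ n) (hn4 : n ≤ 4) (hβ : 0 < β)
    (hv : IsSmoothSolution β T v) (hs : s ∈ Ico 0 T) {t : ℝ} (ht : t ∈ Ioc s T) :
    ∀ᵐ ξ : E n, phase β (t - s) ξ * (𝓕 (v t) : L2 n) ξ =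
      (𝓕 (v s) : L2 n) ξ + Complex.I * ((t - s : ℝ) : ℂ) * meanForce β v s t ξ := by
  have hs' : s ∈ Icc 0 T := ⟨hs.1, hs.2.le⟩
  have ht' : t ∈ Icc 0 T := ⟨hs.1.trans ht.1.le, ht.2⟩
  have h0 : (0 : ℝ) ∈ Icc 0 T := ⟨le_rfl, hs.1.trans hs.2.le⟩
  have hts : ((t - s : ℝ) : ℂ) ≠ 0 := by exact_mod_cast (sub_pos.2 ht.1).ne'
  filter_upwards [hv.duhamel t ht', hv.duhamel s hs'] with ξ h1 h2
  -- Every propagator is referred to the time `s`, so that the formulas at `t` and at `s` have the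
  -- same integrand and subtract to an integral over `[s, t]`.
  have e : ∀ τ : ℝ, ∀ r : ℝ, Complex.exp (-Complex.I * (τ - r) * symb β ξ) * cubicHat (v r) ξ =
      phase β (s - τ) ξ * (phase β (r - s) ξ * cubicHat (v r) ξ) := by
    intro τ r
    rw [← mul_assoc, ← phase_add, phase]
    congr 2; push_cast; ring
  have e0 : ∀ τ : ℝ, Complex.exp (-Complex.I * τ * symb β ξ) =
      phase β (s - τ) ξ * phase β (-s) ξ := by
    intro τ
    rw [← phase_add, phase]
    congr 1; push_cast; ring
  simp only [e, e0, intervalIntegral.integral_const_mul] at h1 h2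
  rw [sub_self, phase_zero, one_mul, one_mul] at h2
  have h3 : phase β (t - s) ξ * phase β (s - t) ξ = 1 := by
    rw [← phase_add]; simp [phase_zero]
  rw [h1, h2, meanForce, ← intervalIntegral.integral_add_adjacent_intervals
    (hv.intervalIntegrable hn hn4 hβ ξ s h0 hs') (hv.intervalIntegrable hn hn4 hβ ξ s hs' ht')]
  rw [show ∀ I D X : ℂ, D ≠ 0 → I * D * (D⁻¹ * X) = I * X by intros; field_simp]
  · linear_combination (phase β (-s) ξ * (𝓕 (v 0) : L2 n) ξ + Complex.I *
      ((∫ r in (0 : ℝ)..s, phase β (r - s) ξ * cubicHat (v r) ξ) +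
        ∫ r in s..t, phase β (r - s) ξ * cubicHat (v r) ξ)) * h3
  · exact hts

/-- Measurability in `ξ` of the parametric integral is read off Duhamel's formula, which makes it a
difference quotient of `L²` functions. -/
theorem IsSmoothSolution.aestronglyMeasurable_meanForce (hn : 1 ≤ n) (hn4 : n ≤ 4) (hβ : 0 < β)
    (hv : IsSmoothSolution β T v) (hs : s ∈ Ico 0 T) {t : ℝ} (ht : t ∈ Ioc s T) :
    AEStronglyMeasurable (meanForce β v s t) volume := by
  have hts : ((t - s : ℝ) : ℂ) ≠ 0 := by exact_mod_cast (sub_pos.2 ht.1).ne'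
  have h : AEStronglyMeasurable (fun ξ => (Complex.I * ((t - s : ℝ) : ℂ))⁻¹ *
      (phase β (t - s) ξ * (𝓕 (v t) : L2 n) ξ - (𝓕 (v s) : L2 n) ξ)) volume :=
    ((AEStronglyMeasurable.mul (by fun_prop) (Lp.aestronglyMeasurable _)).sub
      (Lp.aestronglyMeasurable _)).const_mul _
  refine h.congr ?_
  filter_upwards [hv.phase_mul_fourier hn hn4 hβ hs ht] with ξ hξ
  rw [hξ]
  field_simp
  ring

/-- The mean force tends to the force in weighted `L²` norms. -/
theorem IsSmoothSolution.tendsto_meanForce (hn : 1 ≤ n) (hn4 : n ≤ 4) (hβ : 0 < β)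
    (hv : IsSmoothSolution β T v) (hs : s ∈ Ico 0 T) {w : E n → ℝ} (hw : Measurable w)
    (hG : MemLp (fun ξ => (w ξ : ℂ) * cubicHat (v s) ξ) 2 volume)
    (hGl : Tendsto (fun t => eLpNorm (fun ξ => (w ξ : ℂ) * (cubicHat (v t) ξ - cubicHat (v s) ξ))
      2 volume) (𝓝[>] s) (𝓝 0)) :
    Tendsto (fun t => eLpNorm (fun ξ => (w ξ : ℂ) * meanForce β v s t ξ -
      (w ξ : ℂ) * cubicHat (v s) ξ) 2 volume) (𝓝[>] s) (𝓝 0) := by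
  have hT : 0 ≤ T := hs.1.trans hs.2.le
  have hs' : s ∈ Icc 0 T := ⟨hs.1, hs.2.le⟩
  have hcont : ∀ r ∈ Icc 0 T, Continuous (cubicHat (v r)) := fun r hr =>
    continuous_cubicHat hn hn4 hβ (hv.mem 4 r hr)
  -- The time average of `D` over `[s, t]` is the difference to be estimated. `D` itself tends to
  -- zero: it is `(phase - 1)` times the fixed force at `s`, plus a phase times the increment of the
  -- force.
  set D : ℝ → E n → ℂ := fun r ξ =>
    (w ξ : ℂ) * (phase β (r - s) ξ * cubicHat (v r) ξ - cubicHat (v s) ξ) with hDdef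
  have hmem : ∀ᶠ t in 𝓝[>] s, t ∈ Ioc s T := Ioc_mem_nhdsGT hs.2
  have hD : Tendsto (fun r => eLpNorm (D r) 2 volume) (𝓝[>] s) (𝓝 0) := by
    have h1 := tendsto_eLpNorm_mul_of_bounded (l := 𝓝[>] s)
      (φ := fun t ξ => phase β (t - s) ξ - 1) hG 2
      (Eventually.of_forall fun t => by
        exact Measurable.aestronglyMeasurable (by fun_prop))
      (Eventually.of_forall fun t => Eventually.of_forall fun ξ => norm_phase_sub_one_le_two _ _)
      (Eventually.of_forall fun ξ => tendsto_phase_sub ξ)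
    have h2 := h1.add hGl
    rw [add_zero] at h2
    refine tendsto_of_tendsto_of_tendsto_of_le_of_le' tendsto_const_nhds h2
      (Eventually.of_forall fun _ => zero_le) ?_
    filter_upwards [hmem] with t ht
    have ht' : t ∈ Icc 0 T := ⟨hs.1.trans ht.1.le, ht.2⟩
    have hm1 : AEStronglyMeasurable
        (fun ξ => (phase β (t - s) ξ - 1) * ((w ξ : ℂ) * cubicHat (v s) ξ)) volume :=
      AEStronglyMeasurable.mul (Measurable.aestronglyMeasurable (by fun_prop)) hG.1
    have hm2 : AEStronglyMeasurable
        (fun ξ => phase β (t - s) ξ * ((w ξ : ℂ) * (cubicHat (v t) ξ - cubicHat (v s) ξ)))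
        volume :=
      AEStronglyMeasurable.mul (by fun_prop) (AEStronglyMeasurable.mul (by fun_prop)
        ((hcont t ht').sub (hcont s hs')).aestronglyMeasurable)
    calc eLpNorm (D t) 2 volume = eLpNorm
          ((fun ξ => (phase β (t - s) ξ - 1) * ((w ξ : ℂ) * cubicHat (v s) ξ)) +
          fun ξ => phase β (t - s) ξ * ((w ξ : ℂ) * (cubicHat (v t) ξ - cubicHat (v s) ξ)))
          2 volume := by
          congr 1; ext ξ; simp only [hDdef, Pi.add_apply]; ring
      _ ≤ _ := eLpNorm_add_le hm1 hm2 (by norm_num)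
      _ = _ := by
          congr 1
          refine eLpNorm_congr_norm_ae (Eventually.of_forall fun ξ => ?_)
          rw [norm_mul, norm_phase, one_mul]
  have hDm : AEStronglyMeasurable (Function.uncurry D)
      ((volume.restrict (Ioc s T)).prod (volume : Measure (E n))) := by
    -- Continuity in time and measurability in `ξ` give joint measurability, but need all real
    -- times; `projIcc` freezes the solution outside `[0, T]` and changes nothing on `Ioc s T`.
    have h1 : StronglyMeasurable (Function.uncurry fun (r : ℝ) (ξ : E n) =>
        cubicHat (v (projIcc 0 T hT r)) ξ) := by
      refine stronglyMeasurable_uncurry_of_continuous_of_stronglyMeasurable (fun ξ => ?_)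
        fun r => (hcont _ (projIcc 0 T hT r).2).stronglyMeasurable
      exact (continuousOn_iff_continuous_domRestrict.1
        (hv.continuousOn_cubicHat hn hn4 hβ ξ)).comp continuous_projIcc
    have h2 : Measurable (fun p : ℝ × E n => phase β (p.1 - s) p.2) := by
      unfold phase; fun_prop
    have h3 : AEStronglyMeasurable (fun p : ℝ × E n => (w p.2 : ℂ) * (phase β (p.1 - s) p.2 *
        cubicHat (v (projIcc 0 T hT p.1)) p.2 - cubicHat (v s) p.2))
        ((volume.restrict (Ioc s T)).prod (volume : Measure (E n))) := by
      refine AEStronglyMeasurable.mul (Measurable.aestronglyMeasurable (by fun_prop)) ?_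
      refine AEStronglyMeasurable.sub (h2.aestronglyMeasurable.mul h1.aestronglyMeasurable) ?_
      exact ((hcont s hs').comp continuous_snd).aestronglyMeasurable
    refine h3.congr ?_
    have h4 : ∀ᵐ r ∂(volume.restrict (Ioc s T)), r ∈ Ioc s T := ae_restrict_mem measurableSet_Ioc
    have h5 := Measure.quasiMeasurePreserving_fst (μ := volume.restrict (Ioc s T))
      (ν := (volume : Measure (E n))) |>.ae h4
    filter_upwards [h5] with p hp
    have : (projIcc 0 T hT p.1 : ℝ) = p.1 := by
      rw [projIcc_of_mem hT ⟨hs.1.trans hp.1.le, hp.2⟩]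
    simp only [this, hDdef, Function.uncurry]
  refine (tendsto_eLpNorm_average hs.2 hDm hD).congr' ?_
  filter_upwards [hmem] with t ht
  have ht' : t ∈ Icc 0 T := ⟨hs.1.trans ht.1.le, ht.2⟩
  have hts : ((t - s : ℝ) : ℂ) ≠ 0 := by exact_mod_cast (sub_pos.2 ht.1).ne'
  congr 1
  ext ξ
  simp only [hDdef, meanForce]
  rw [intervalIntegral.integral_const_mul, intervalIntegral.integral_sub
    (hv.intervalIntegrable hn hn4 hβ ξ s hs' ht') intervalIntegrable_const,
    intervalIntegral.integral_const, Complex.real_smul]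
  field_simp

end smooth

/-! ### Right derivatives of quadratic functionals. -/

section smooth

variable {n : ℕ} {β T : ℝ} {v : ℝ → L2 n} {s : ℝ}

theorem IsSmoothSolution.eventually_memLp_meanForce (hn : 1 ≤ n) (hn4 : n ≤ 4) (hβ : 0 < β)
    (hv : IsSmoothSolution β T v) (hs : s ∈ Ico 0 T) {w : E n → ℝ} (hw : Measurable w)
    (hG : MemLp (fun ξ => (w ξ : ℂ) * cubicHat (v s) ξ) 2 volume)
    (hJ : Tendsto (fun t => eLpNorm (fun ξ => (w ξ : ℂ) * meanForce β v s t ξ -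
      (w ξ : ℂ) * cubicHat (v s) ξ) 2 volume) (𝓝[>] s) (𝓝 0)) :
    ∀ᶠ t in 𝓝[>] s, MemLp (fun ξ => (w ξ : ℂ) * meanForce β v s t ξ) 2 volume := by
  have hmem : ∀ᶠ t in 𝓝[>] s, t ∈ Ioc s T := Ioc_mem_nhdsGT hs.2
  filter_upwards [hmem, hJ.eventually (eventually_lt_nhds ENNReal.zero_lt_top)] with t ht hfin
  have hm : AEStronglyMeasurable (fun ξ => (w ξ : ℂ) * meanForce β v s t ξ) volume :=
    AEStronglyMeasurable.mul (by fun_prop) (hv.aestronglyMeasurable_meanForce hn hn4 hβ hs ht)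
  have h : MemLp (fun ξ => (w ξ : ℂ) * meanForce β v s t ξ -
      (w ξ : ℂ) * cubicHat (v s) ξ) 2 volume := ⟨hm.sub hG.1, hfin⟩
  convert h.add hG using 1
  ext ξ
  simp only [Pi.add_apply, sub_add_cancel]

/-- In the interaction picture the solution is continuous in weighted `L²` norms. -/
theorem tendsto_phase_mul_fourier {w : E n → ℝ} (hw : Measurable w)
    (hV : MemLp (fun ξ => (w ξ : ℂ) * (𝓕 (v s) : L2 n) ξ) 2 volume)
    (hVl : Tendsto (fun t => eLpNorm (fun ξ => (w ξ : ℂ) * (𝓕 (v t - v s) : L2 n) ξ) 2 volume)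
      (𝓝[>] s) (𝓝 0)) :
    Tendsto (fun t => eLpNorm (fun ξ => (w ξ : ℂ) * (phase β (t - s) ξ * (𝓕 (v t) : L2 n) ξ +
      (𝓕 (v s) : L2 n) ξ) - 2 * ((w ξ : ℂ) * (𝓕 (v s) : L2 n) ξ)) 2 volume) (𝓝[>] s) (𝓝 0) := by
  have h1 := tendsto_eLpNorm_mul_of_bounded (l := 𝓝[>] s)
    (φ := fun t ξ => phase β (t - s) ξ - 1) hV 2
    (Eventually.of_forall fun t => by
      exact Measurable.aestronglyMeasurable (by fun_prop))
    (Eventually.of_forall fun t => Eventually.of_forall fun ξ => norm_phase_sub_one_le_two _ _)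
    (Eventually.of_forall fun ξ => tendsto_phase_sub ξ)
  have h2 := h1.add hVl
  rw [add_zero] at h2
  refine tendsto_of_tendsto_of_tendsto_of_le_of_le tendsto_const_nhds h2
    (fun _ => zero_le) fun t => ?_
  have hm1 : AEStronglyMeasurable
      (fun ξ => (phase β (t - s) ξ - 1) * ((w ξ : ℂ) * (𝓕 (v s) : L2 n) ξ)) volume :=
    AEStronglyMeasurable.mul (Measurable.aestronglyMeasurable (by fun_prop)) hV.1
  have hm2 : AEStronglyMeasurable
      (fun ξ => phase β (t - s) ξ * ((w ξ : ℂ) * (𝓕 (v t - v s) : L2 n) ξ)) volume :=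
    AEStronglyMeasurable.mul (by fun_prop) (AEStronglyMeasurable.mul (by fun_prop)
      (Lp.aestronglyMeasurable _))
  calc _ = eLpNorm ((fun ξ => (phase β (t - s) ξ - 1) * ((w ξ : ℂ) * (𝓕 (v s) : L2 n) ξ)) +
        fun ξ => phase β (t - s) ξ * ((w ξ : ℂ) * (𝓕 (v t - v s) : L2 n) ξ)) 2 volume := by
        refine eLpNorm_congr_ae ?_
        filter_upwards [fourier_sub_ae (v t) (v s)] with ξ hξ
        rw [Pi.add_apply, hξ]; ring
    _ ≤ _ := eLpNorm_add_le hm1 hm2 (by norm_num)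
    _ = _ := by
        congr 1
        refine eLpNorm_congr_norm_ae (Eventually.of_forall fun ξ => ?_)
        rw [norm_mul, norm_phase, one_mul]

theorem integrable_conj_mul {α : Type*} [MeasurableSpace α] {μ : Measure α} {f g : α → ℂ}
    (hf : MemLp f 2 μ) (hg : MemLp g 2 μ) :
    Integrable (fun x => (starRingEnd ℂ) (f x) * g x) μ :=
  hf.star.integrable_mul hg

/-- This turns an increment of squares into a sum, which converges, times a difference, which
Duhamel's formula makes explicit. -/
theorem norm_sq_sub_norm_sq (a b : ℂ) :
    ‖a‖ ^ 2 - ‖b‖ ^ 2 = ((starRingEnd ℂ) (a + b) * (a - b)).re := by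
  rw [← Complex.normSq_eq_norm_sq, ← Complex.normSq_eq_norm_sq]
  simp only [Complex.normSq_apply, Complex.mul_re, Complex.conj_re, Complex.conj_im,
    Complex.add_re, Complex.add_im, Complex.sub_re, Complex.sub_im]
  ring

/-- Right derivative of a weighted quadratic functional along a smooth solution. The weight is
split as `q q'`, where `q` is put on the solution and `q'` on the force. -/
theorem IsSmoothSolution.hasDerivWithinAt_quadratic (hn : 1 ≤ n) (hn4 : n ≤ 4) (hβ : 0 < β)
    (hv : IsSmoothSolution β T v) (hs : s ∈ Ico 0 T) {q q' : E n → ℝ} (hq : Measurable q)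
    (hq' : Measurable q')
    (hV : ∀ t ∈ Icc 0 T, MemLp (fun ξ => (q ξ : ℂ) * (𝓕 (v t) : L2 n) ξ) 2 volume)
    (hVl : Tendsto (fun t => eLpNorm (fun ξ => (q ξ : ℂ) * (𝓕 (v t - v s) : L2 n) ξ) 2 volume)
      (𝓝[>] s) (𝓝 0))
    (hG : MemLp (fun ξ => (q' ξ : ℂ) * cubicHat (v s) ξ) 2 volume)
    (hGl : Tendsto (fun t => eLpNorm (fun ξ => (q' ξ : ℂ) * (cubicHat (v t) ξ - cubicHat (v s) ξ))
      2 volume) (𝓝[>] s) (𝓝 0))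
    (hint : ∀ t ∈ Icc 0 T, Integrable (fun ξ => q ξ * q' ξ * ‖(𝓕 (v t) : L2 n) ξ‖ ^ 2)) :
    HasDerivWithinAt (fun t => ∫ ξ, q ξ * q' ξ * ‖(𝓕 (v t) : L2 n) ξ‖ ^ 2)
      (2 * (Complex.I * ∫ ξ, (starRingEnd ℂ) ((q ξ : ℂ) * (𝓕 (v s) : L2 n) ξ) *
        ((q' ξ : ℂ) * cubicHat (v s) ξ)).re) (Ici s) s := by
  have hs' : s ∈ Icc 0 T := ⟨hs.1, hs.2.le⟩
  have hmem : ∀ᶠ t in 𝓝[>] s, t ∈ Ioc s T := Ioc_mem_nhdsGT hs.2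
  have hJ := hv.tendsto_meanForce hn hn4 hβ hs hq' hG hGl
  have hJm := hv.eventually_memLp_meanForce hn hn4 hβ hs hq' hG hJ
  have hA := tendsto_phase_mul_fourier (β := β) hq (hV s hs') hVl
  have hAm : ∀ᶠ t in 𝓝[>] s, MemLp (fun ξ => (q ξ : ℂ) * (phase β (t - s) ξ *
      (𝓕 (v t) : L2 n) ξ + (𝓕 (v s) : L2 n) ξ)) 2 volume := by
    filter_upwards [hmem] with t ht
    have ht' : t ∈ Icc 0 T := ⟨hs.1.trans ht.1.le, ht.2⟩
    have h1 : MemLp (fun ξ => phase β (t - s) ξ * ((q ξ : ℂ) * (𝓕 (v t) : L2 n) ξ)) 2 volume :=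
      (hV t ht').of_le (AEStronglyMeasurable.mul (by fun_prop) (hV t ht').1)
        (Eventually.of_forall fun ξ => by rw [norm_mul, norm_phase, one_mul])
    convert h1.add (hV s hs') using 1
    ext ξ
    simp only [Pi.add_apply]
    ring
  rw [← hasDerivWithinAt_Ioi_iff_Ici, hasDerivWithinAt_iff_tendsto_slope' (by simp)]
  have hlim := tendsto_integral_conj_mul hAm hJm ((hV s hs').const_mul 2) hG hA hJ
  have hlim2 := (Complex.continuous_re.tendsto _).comp (hlim.const_mul Complex.I)
  have e : (Complex.I * ∫ ξ, (starRingEnd ℂ) (2 * ((q ξ : ℂ) * (𝓕 (v s) : L2 n) ξ)) *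
        ((q' ξ : ℂ) * cubicHat (v s) ξ)).re = 2 * (Complex.I * ∫ ξ, (starRingEnd ℂ)
        ((q ξ : ℂ) * (𝓕 (v s) : L2 n) ξ) * ((q' ξ : ℂ) * cubicHat (v s) ξ)).re := by
    have : ∀ ξ, (starRingEnd ℂ) (2 * ((q ξ : ℂ) * (𝓕 (v s) : L2 n) ξ)) *
        ((q' ξ : ℂ) * cubicHat (v s) ξ) = 2 * ((starRingEnd ℂ)
        ((q ξ : ℂ) * (𝓕 (v s) : L2 n) ξ) * ((q' ξ : ℂ) * cubicHat (v s) ξ)) := by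
      intro ξ
      rw [map_mul, Complex.conj_ofNat, mul_assoc]
    simp only [this, integral_const_mul]
    rw [mul_left_comm, Complex.mul_re]
    simp
  rw [e] at hlim2
  refine hlim2.congr' ?_
  filter_upwards [hmem, hAm, hJm] with t ht hAt hJt
  have ht' : t ∈ Icc 0 T := ⟨hs.1.trans ht.1.le, ht.2⟩
  have hts : t - s ≠ 0 := (sub_pos.2 ht.1).ne'
  rw [slope_def_field, ← integral_sub (hint t ht') (hint s hs'), div_eq_inv_mul,
    ← integral_const_mul, Function.comp, ← integral_const_mul]
  rw [show ∀ f : E n → ℂ, Integrable f → (∫ ξ, f ξ).re = ∫ ξ, (f ξ).re from fun f hf =>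
    (integral_re hf).symm]
  · refine integral_congr_ae ?_
    filter_upwards [hv.phase_mul_fourier hn hn4 hβ hs ht] with ξ hξ
    -- The phase has modulus one, so the linear evolution drops out of the functional and only the
    -- force contributes to the slope.
    have h1 : ‖(𝓕 (v t) : L2 n) ξ‖ = ‖phase β (t - s) ξ * (𝓕 (v t) : L2 n) ξ‖ := by
      rw [norm_mul, norm_phase, one_mul]
    rw [← mul_sub, h1, norm_sq_sub_norm_sq]
    set a := phase β (t - s) ξ * (𝓕 (v t) : L2 n) ξ
    set b := (𝓕 (v s) : L2 n) ξ
    have h2 : a - b = Complex.I * ((t - s : ℝ) : ℂ) * meanForce β v s t ξ := by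
      rw [hξ]; ring
    rw [h2, ← Complex.re_ofReal_mul, ← Complex.re_ofReal_mul]
    congr 1
    have h3 : ((t - s : ℝ) : ℂ) ≠ 0 := by exact_mod_cast hts
    rw [map_mul, Complex.conj_ofReal, Complex.ofReal_inv, Complex.ofReal_mul]
    field_simp
  · exact (integrable_conj_mul hAt hJt).const_mul _

end smooth

/-! ### Rates of change of mass, quadratic energy and `L⁴` norm. -/

/-- With `d = b - a` and `R = Re(ā d)` the remainder is exactly `2|a|²|d|² + (2R + |d|²)²`. As `|d|
≤ 2M`, the bracket is at most `4M|d|`, which gives `18 = 2 + 16`. -/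
theorem abs_norm_pow_four_sub_le {M : ℝ} {a b : ℂ} (ha : ‖a‖ ≤ M) (hb : ‖b‖ ≤ M) :
    |‖b‖ ^ 4 - ‖a‖ ^ 4 - 4 * ((starRingEnd ℂ) (((‖a‖ ^ 2 : ℝ) : ℂ) * a) * (b - a)).re| ≤
      18 * M ^ 2 * ‖b - a‖ ^ 2 := by
  obtain ⟨d, rfl⟩ : ∃ d, b = a + d := ⟨b - a, by ring⟩
  rw [add_sub_cancel_left]
  have hd : ‖d‖ ≤ 2 * M := by
    calc ‖d‖ = ‖a + d - a‖ := by rw [add_sub_cancel_left]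
      _ ≤ ‖a + d‖ + ‖a‖ := norm_sub_le _ _
      _ ≤ 2 * M := by linarith
  have hM : 0 ≤ M := (norm_nonneg a).trans ha
  set R := ((starRingEnd ℂ) a * d).re with hR
  have hRle : |R| ≤ M * ‖d‖ := by
    calc |R| ≤ ‖(starRingEnd ℂ) a * d‖ := Complex.abs_re_le_norm _
      _ = ‖a‖ * ‖d‖ := by rw [norm_mul, Complex.norm_conj]
      _ ≤ _ := by gcongr
  have e1 : ‖a + d‖ ^ 2 = ‖a‖ ^ 2 + (2 * R + ‖d‖ ^ 2) := by
    simp only [hR, ← Complex.normSq_eq_norm_sq, Complex.normSq_apply, Complex.mul_re,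
      Complex.conj_re, Complex.conj_im, Complex.add_re, Complex.add_im]
    ring
  have e2 : ((starRingEnd ℂ) (((‖a‖ ^ 2 : ℝ) : ℂ) * a) * d).re = ‖a‖ ^ 2 * R := by
    rw [map_mul, Complex.conj_ofReal, mul_assoc, Complex.re_ofReal_mul]
  have e3 : ‖a + d‖ ^ 4 - ‖a‖ ^ 4 - 4 * (‖a‖ ^ 2 * R) =
      2 * ‖a‖ ^ 2 * ‖d‖ ^ 2 + (2 * R + ‖d‖ ^ 2) ^ 2 := by
    rw [show ‖a + d‖ ^ 4 = (‖a + d‖ ^ 2) ^ 2 by ring, e1]; ring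
  rw [e2, e3, abs_of_nonneg (by positivity)]
  have h1 : |2 * R + ‖d‖ ^ 2| ≤ 4 * M * ‖d‖ := by
    refine (abs_add_le _ _).trans ?_
    rw [abs_mul, abs_two, abs_of_nonneg (sq_nonneg ‖d‖)]
    nlinarith [norm_nonneg d]
  have h2 : (2 * R + ‖d‖ ^ 2) ^ 2 ≤ (4 * M * ‖d‖) ^ 2 := sq_le_sq' (abs_le.1 h1).1 (abs_le.1 h1).2
  have h3 : ‖a‖ ^ 2 ≤ M ^ 2 := by gcongr
  nlinarith [mul_le_mul_of_nonneg_right h3 (sq_nonneg ‖d‖)]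

section smooth

variable {n : ℕ} {β T : ℝ} {v : ℝ → L2 n} {s : ℝ}

theorem IsSmoothSolution.memLp_wt_fourier (hv : IsSmoothSolution β T v) {t : ℝ}
    (ht : t ∈ Icc 0 T) : MemLp (fun ξ => (wt β ξ : ℂ) * (𝓕 (v t) : L2 n) ξ) 2 volume :=
  ⟨AEStronglyMeasurable.mul (by fun_prop) (Lp.aestronglyMeasurable _), hv.mem 4 t ht⟩

theorem norm_sq_eq_integral (u : L2 n) : ‖u‖ ^ 2 = ∫ x, ‖u x‖ ^ 2 := by
  have h := L2.inner_def (𝕜 := ℂ) u u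
  rw [inner_self_eq_norm_sq_to_K] at h
  have h2 : (∫ a, inner ℂ (u a) (u a)) = ((∫ x, ‖u x‖ ^ 2 : ℝ) : ℂ) := by
    rw [← integral_complex_ofReal]
    refine integral_congr_ae (Eventually.of_forall fun x => ?_)
    simp only [inner_self_eq_norm_sq_to_K]
    norm_cast
  rw [h2] at h
  have h3 : ((‖u‖ ^ 2 : ℝ) : ℂ) = ((∫ x, ‖u x‖ ^ 2 : ℝ) : ℂ) := by
    rw [Complex.ofReal_pow]
    exact h
  exact Complex.ofReal_injective h3

theorem norm_sq_eq_integral_fourier (u : L2 n) : ‖u‖ ^ 2 = ∫ ξ, ‖(𝓕 u : L2 n) ξ‖ ^ 2 := by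
  rw [← norm_sq_eq_integral, Lp.norm_fourier_eq]

/-- Conservation of mass, infinitesimally. -/
theorem IsSmoothSolution.hasDerivWithinAt_mass (hn : 1 ≤ n) (hn4 : n ≤ 4) (hβ : 0 < β)
    (hv : IsSmoothSolution β T v) (hs : s ∈ Ico 0 T) :
    HasDerivWithinAt (fun t => mass (v t)) 0 (Ici s) s := by
  have hs' : s ∈ Icc 0 T := ⟨hs.1, hs.2.le⟩
  have hl := hv.tendsto_nhdsGT hs
  have hms := hv.mem 4 s hs'
  have h := hv.hasDerivWithinAt_quadratic hn hn4 hβ hs (q := fun _ => 1) (q' := fun _ => 1)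
    measurable_const measurable_const
    (fun t _ => by simpa using! Lp.memLp (𝓕 (v t) : L2 n))
    (by simpa [eLpNorm_fourier_coe] using! tendsto_enorm_sub hn hβ hl)
    (by simpa using! memLp_cubicHat hn hn4 hβ hms)
    (by simpa using! tendsto_eLpNorm_cubicHat_sub hn hn4 hβ hms hl)
    (fun t _ => by
      simpa using! (memLp_two_iff_integrable_sq_norm (Lp.aestronglyMeasurable _)).1
        (Lp.memLp (𝓕 (v t) : L2 n)))
  simp only [mul_one, one_mul, Complex.ofReal_one, ← norm_sq_eq_integral_fourier] at h
  obtain ⟨M, hM⟩ := exists_norm_le hn hn4 hβ hms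
  have h1 := integral_fourier_mul_conj (integrable_cubic hM) (memLp_cubic hM) (v s)
  -- The pairing of the solution with its force is the real number `∫|v|⁴`, so multiplied by `i` it
  -- has no real part.
  have h2 : ∫ ξ, (starRingEnd ℂ) ((𝓕 (v s) : L2 n) ξ) * cubicHat (v s) ξ =
      ((∫ x, ‖v s x‖ ^ 4 : ℝ) : ℂ) := by
    have e1 : ∀ ξ, (starRingEnd ℂ) ((𝓕 (v s) : L2 n) ξ) * cubicHat (v s) ξ =
        (starRingEnd ℂ) ((starRingEnd ℂ) (𝓕 (cubic (v s)) ξ) * (𝓕 (v s) : L2 n) ξ) := by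
      intro ξ
      rw [map_mul, Complex.conj_conj, mul_comm]; rfl
    simp only [e1]
    rw [integral_conj, h1, ← integral_conj, ← integral_complex_ofReal]
    refine integral_congr_ae (Eventually.of_forall fun x => ?_)
    simp only [cubic, map_mul, Complex.conj_conj, Complex.conj_ofReal]
    rw [mul_assoc, Complex.mul_conj, Complex.normSq_eq_norm_sq]
    push_cast; ring
  rw [h2] at h
  simpa using! h

theorem IsSmoothSolution.integrable_symb (hn : 1 ≤ n) (hβ : 0 < β)
    (hv : IsSmoothSolution β T v) {t : ℝ} (ht : t ∈ Icc 0 T) :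
    Integrable (fun ξ => symb β ξ * ‖(𝓕 (v t) : L2 n) ξ‖ ^ 2) := by
  have h := (memLp_two_iff_integrable_sq_norm (hv.memLp_wt_fourier ht).1).1
    (hv.memLp_wt_fourier ht)
  refine (h.const_mul 2).mono' ?_ ?_
  · exact AEStronglyMeasurable.mul (by fun_prop) ((Lp.aestronglyMeasurable _).norm.pow 2)
  · filter_upwards [ae_ne_zero hn] with ξ hξ
    have h1 := symb_le_wt_sq hβ hξ
    rw [norm_mul, norm_mul, Complex.norm_real, Real.norm_of_nonneg symb_nonneg,
      Real.norm_of_nonneg (wt_pos hβ hξ).le, norm_pow, norm_norm, mul_pow, ← mul_assoc]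
    gcongr

/-- The pairing that gives the rate of change of the two parts of the energy. -/
noncomputable def energyPairing (β : ℝ) (u : L2 n) : ℂ :=
  ∫ ξ, (starRingEnd ℂ) ((wt β ξ : ℂ) * (𝓕 u : L2 n) ξ) * ((wtDual β ξ : ℂ) * cubicHat u ξ)

/-- Putting the whole symbol on the force would require `r^{-2β}` to be square integrable near the
origin, that is `β < n/4`. The splitting `wt * wtDual` leaves only `r^{-β}` there. -/
theorem IsSmoothSolution.hasDerivWithinAt_kinetic (hn : 1 ≤ n) (hn4 : n ≤ 4) (hβ : 0 < β)
    (hβn : β < n / 2) (hv : IsSmoothSolution β T v) (hs : s ∈ Ico 0 T) :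
    HasDerivWithinAt (fun t => ∫ ξ, symb β ξ * ‖(𝓕 (v t) : L2 n) ξ‖ ^ 2)
      (2 * (Complex.I * energyPairing β (v s)).re) (Ici s) s := by
  have hs' : s ∈ Icc 0 T := ⟨hs.1, hs.2.le⟩
  have hl := hv.tendsto_nhdsGT hs
  have hms := hv.mem 4 s hs'
  have e : ∀ u : L2 n, (fun ξ => wt β ξ * wtDual β ξ * ‖(𝓕 u : L2 n) ξ‖ ^ 2) =ᵐ[volume]
      fun ξ => symb β ξ * ‖(𝓕 u : L2 n) ξ‖ ^ 2 := by
    intro u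
    filter_upwards [ae_ne_zero hn] with ξ hξ
    rw [wt_mul_wtDual hβ hξ]
  have h := hv.hasDerivWithinAt_quadratic hn hn4 hβ hs (q := wt β) (q' := wtDual β)
    (measurable_wt β) (measurable_wtDual β) (fun t ht => hv.memLp_wt_fourier ht)
    hl (memLp_wtDual_cubicHat hn hn4 hβ hβn hms)
    (tendsto_eLpNorm_wtDual_cubicHat_sub hn hn4 hβ hβn hms hl)
    (fun t ht => (integrable_congr (e (v t))).2 (hv.integrable_symb hn hβ ht))
  simp only [fun t => integral_congr_ae (e (v t))] at h
  exact h

theorem tendsto_phase_neg_sub (ξ : E n) :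
    Tendsto (fun t => phase β (-(t - s)) ξ - 1) (𝓝[>] s) (𝓝 0) := by
  have h : Continuous (fun t => phase β (-(t - s)) ξ - 1) :=
    ((continuous_phase_time ξ).comp (continuous_id.sub continuous_const).neg).sub continuous_const
  have := h.tendsto s
  simp only [sub_self, neg_zero, phase_zero] at this
  exact this.mono_left nhdsWithin_le_nhds

/-- The derivative of the linear group at a fixed frequency. -/
theorem tendsto_phase_slope {ξ : E n} (hξ : ξ ≠ 0) :
    Tendsto (fun t => (phase β (-(t - s)) ξ - 1) / (((t - s) * symb β ξ : ℝ) : ℂ)) (𝓝[>] s)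
      (𝓝 (-Complex.I)) := by
  have hm : (symb β ξ : ℂ) ≠ 0 := by exact_mod_cast (symb_pos hξ).ne'
  have h1 : HasDerivAt (fun t : ℝ => phase β (-(t - s)) ξ)
      (Complex.exp (Complex.I * ((-(s - s) * symb β ξ : ℝ) : ℂ)) *
        (Complex.I * ((-1 * symb β ξ : ℝ) : ℂ))) s :=
    (((((hasDerivAt_id s).sub_const s).neg.mul_const (symb β ξ)).ofReal_comp).const_mul
      Complex.I).cexp
  have h2 := (hasDerivAt_iff_tendsto_slope.1 h1).mono_left
    (nhdsWithin_mono s (fun t ht => (ne_of_gt ht : t ≠ s)))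
  have h3 := h2.div_const (symb β ξ : ℂ)
  have e : Complex.exp (Complex.I * ((-(s - s) * symb β ξ : ℝ) : ℂ)) *
        (Complex.I * ((-1 * symb β ξ : ℝ) : ℂ)) / (symb β ξ : ℂ) = -Complex.I := by
    simp only [sub_self, neg_zero, zero_mul, Complex.ofReal_zero, mul_zero, Complex.exp_zero,
      one_mul, Complex.ofReal_mul, Complex.ofReal_neg, Complex.ofReal_one]
    field_simp
  rw [e] at h3
  refine h3.congr fun t => ?_
  rw [slope, vsub_eq_sub, sub_self, neg_zero, phase_zero, Complex.real_smul, Complex.ofReal_inv,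
    Complex.ofReal_mul]
  rw [div_mul_eq_div_div, inv_mul_eq_div]

/-- The increment of a smooth solution on the Fourier side. -/
theorem IsSmoothSolution.fourier_sub (hn : 1 ≤ n) (hn4 : n ≤ 4) (hβ : 0 < β)
    (hv : IsSmoothSolution β T v) (hs : s ∈ Ico 0 T) {t : ℝ} (ht : t ∈ Ioc s T) :
    ∀ᵐ ξ : E n, (𝓕 (v t - v s) : L2 n) ξ = (phase β (-(t - s)) ξ - 1) * (𝓕 (v s) : L2 n) ξ +
      ((t - s : ℝ) : ℂ) * (Complex.I * (phase β (-(t - s)) ξ * meanForce β v s t ξ)) := by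
  filter_upwards [hv.phase_mul_fourier hn hn4 hβ hs ht, fourier_sub_ae (v t) (v s)] with ξ h1 h2
  have h3 := phase_neg_mul (β := β) (t - s) ξ
  rw [h2]
  linear_combination phase β (-(t - s)) ξ * h1 - (𝓕 (v t) : L2 n) ξ * h3

theorem IsSmoothSolution.tendsto_meanForce_one (hn : 1 ≤ n) (hn4 : n ≤ 4) (hβ : 0 < β)
    (hv : IsSmoothSolution β T v) (hs : s ∈ Ico 0 T) :
    Tendsto (fun t => eLpNorm (fun ξ => meanForce β v s t ξ - cubicHat (v s) ξ) 2 volume)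
        (𝓝[>] s) (𝓝 0) ∧
      ∀ᶠ t in 𝓝[>] s, MemLp (meanForce β v s t) 2 volume := by
  have hms := hv.mem 4 s ⟨hs.1, hs.2.le⟩
  have hG : MemLp (fun ξ => ((1 : ℝ) : ℂ) * cubicHat (v s) ξ) 2 volume := by
    simpa using! memLp_cubicHat hn hn4 hβ hms
  have h1 := hv.tendsto_meanForce hn hn4 hβ hs (w := fun _ => 1) measurable_const hG
    (by simpa using! tendsto_eLpNorm_cubicHat_sub hn hn4 hβ hms (hv.tendsto_nhdsGT hs))
  have h2 := hv.eventually_memLp_meanForce hn hn4 hβ hs (w := fun _ => 1) measurable_const hG h1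
  simp only [Complex.ofReal_one, one_mul] at h1 h2
  exact ⟨h1, h2⟩

/-- Along a smooth solution the increments are `o(√h)` in `L²`. -/
theorem IsSmoothSolution.tendsto_norm_sub_sq_div (hn : 1 ≤ n) (hn4 : n ≤ 4) (hβ : 0 < β)
    (hv : IsSmoothSolution β T v) (hs : s ∈ Ico 0 T) :
    Tendsto (fun t => (t - s)⁻¹ * ‖v t - v s‖ ^ 2) (𝓝[>] s) (𝓝 0) := by
  have hs' : s ∈ Icc 0 T := ⟨hs.1, hs.2.le⟩
  have hms := hv.mem 4 s hs'
  have hmem : ∀ᶠ t in 𝓝[>] s, t ∈ Ioc s T := Ioc_mem_nhdsGT hs.2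
  obtain ⟨hJ, hJm⟩ := hv.tendsto_meanForce_one hn hn4 hβ hs
  have hG := memLp_cubicHat hn hn4 hβ hms
  have hsqrt : Tendsto (fun t => Real.sqrt (t - s)) (𝓝[>] s) (𝓝 0) := by
    have : Continuous fun t => Real.sqrt (t - s) := by fun_prop
    simpa using (this.tendsto s).mono_left (nhdsWithin_le_nhds (s := Ioi s))
  -- The linear part of the increment divided by `√h`, `h = t - s`, with `wt` moved to the solution.
  -- It is bounded by `2`, from `|phase - 1|² ≤ 2 h symb ≤ 4 h wt²`, and tends to zero pointwise
  -- like `√h symb / wt`. The forced part is `h` times a bounded quantity.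
  set ψ : ℝ → E n → ℂ := fun t ξ =>
    (phase β (-(t - s)) ξ - 1) / ((Real.sqrt (t - s) * wt β ξ : ℝ) : ℂ) with hψ
  have hψ1 : Tendsto (fun t => eLpNorm (fun ξ => ψ t ξ * ((wt β ξ : ℂ) * (𝓕 (v s) : L2 n) ξ))
      2 volume) (𝓝[>] s) (𝓝 0) := by
    refine tendsto_eLpNorm_mul_of_bounded (hv.memLp_wt_fourier hs') 2
      (Eventually.of_forall fun t => ?_) ?_ ?_
    · exact Measurable.aestronglyMeasurable (by fun_prop)
    · filter_upwards [hmem] with t ht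
      have hpos : 0 < t - s := sub_pos.2 ht.1
      filter_upwards [ae_ne_zero hn] with ξ hξ
      have hw := wt_pos hβ hξ
      have h1 := norm_phase_sub_one_sq_le (β := β) (-(t - s)) ξ
      have h2 := symb_le_wt_sq hβ hξ
      rw [abs_neg, abs_of_pos hpos] at h1
      rw [hψ, norm_div, Complex.norm_real, Real.norm_of_nonneg (by positivity),
        div_le_iff₀ (by positivity)]
      refine (sq_le_sq₀ (norm_nonneg _) (by positivity)).1 ?_
      rw [mul_pow, mul_pow, Real.sq_sqrt hpos.le]
      nlinarith [mul_le_mul_of_nonneg_left h2 hpos.le]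
    · filter_upwards [ae_ne_zero hn] with ξ hξ
      have hw := wt_pos hβ hξ
      have h1 := hsqrt.mul_const (symb β ξ / wt β ξ)
      rw [zero_mul] at h1
      refine squeeze_zero_norm' ?_ h1
      filter_upwards [hmem] with t ht
      have hpos : 0 < t - s := sub_pos.2 ht.1
      have h2 := norm_phase_sub_one_le (β := β) (-(t - s)) ξ
      rw [abs_neg, abs_of_pos hpos] at h2
      have h3 := Real.sqrt_pos.2 hpos
      rw [hψ, norm_div, Complex.norm_real, Real.norm_of_nonneg (by positivity),
        div_le_iff₀ (by positivity)]
      refine h2.trans (le_of_eq ?_)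
      field_simp
      rw [Real.sq_sqrt hpos.le, mul_comm]
  have hsq2 : Tendsto (fun t => ENNReal.ofReal (Real.sqrt (t - s)) *
      (1 + eLpNorm (cubicHat (v s)) 2 volume)) (𝓝[>] s) (𝓝 0) := by
    have := ENNReal.Tendsto.mul_const (b := 1 + eLpNorm (cubicHat (v s)) 2 volume)
      (ENNReal.tendsto_ofReal hsqrt) (Or.inr (by simpa using hG.2.ne))
    simpa using this
  have hsum := hψ1.add hsq2
  rw [add_zero] at hsum
  have key : Tendsto (fun t => ENNReal.ofReal ((Real.sqrt (t - s))⁻¹ * ‖v t - v s‖)) (𝓝[>] s)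
      (𝓝 0) := by
    refine tendsto_of_tendsto_of_tendsto_of_le_of_le' tendsto_const_nhds hsum
      (Eventually.of_forall fun _ => zero_le) ?_
    filter_upwards [hmem, hJm, hJ.eventually (eventually_le_nhds one_pos)] with t ht hJt hJ1
    have hpos : 0 < t - s := sub_pos.2 ht.1
    have h3 := Real.sqrt_pos.2 hpos
    have hJn : eLpNorm (meanForce β v s t) 2 volume ≤ 1 + eLpNorm (cubicHat (v s)) 2 volume := by
      calc eLpNorm (meanForce β v s t) 2 volume
          = eLpNorm ((fun ξ => meanForce β v s t ξ - cubicHat (v s) ξ) + cubicHat (v s))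
            2 volume := by congr 1; ext ξ; simp
        _ ≤ _ := eLpNorm_add_le (hJt.1.sub hG.1) hG.1 (by norm_num)
        _ ≤ _ := by gcongr
    have hψm : AEStronglyMeasurable (fun ξ => ψ t ξ * ((wt β ξ : ℂ) * (𝓕 (v s) : L2 n) ξ))
        volume :=
      AEStronglyMeasurable.mul (Measurable.aestronglyMeasurable (by fun_prop))
        (hv.memLp_wt_fourier hs').1
    have hJmm : AEStronglyMeasurable (fun ξ => phase β (-(t - s)) ξ * meanForce β v s t ξ)
        volume := AEStronglyMeasurable.mul (by fun_prop) hJt.1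
    have hc : ENNReal.ofReal ((Real.sqrt (t - s))⁻¹ * ‖v t - v s‖) =
        eLpNorm (((Real.sqrt (t - s) : ℝ) : ℂ)⁻¹ • ((𝓕 (v t - v s) : L2 n) : E n → ℂ))
          2 volume := by
      rw [eLpNorm_const_smul, eLpNorm_fourier_coe, ENNReal.ofReal_mul (by positivity), ofReal_norm,
        ← Complex.ofReal_inv, ← ofReal_norm (((Real.sqrt (t - s))⁻¹ : ℝ) : ℂ), Complex.norm_real,
        Real.norm_of_nonneg (by positivity)]
    rw [hc]
    calc _ = eLpNorm ((fun ξ => ψ t ξ * ((wt β ξ : ℂ) * (𝓕 (v s) : L2 n) ξ)) +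
          (((Real.sqrt (t - s) : ℝ) : ℂ) * Complex.I) •
            fun ξ => phase β (-(t - s)) ξ * meanForce β v s t ξ) 2 volume := by
          refine eLpNorm_congr_ae ?_
          filter_upwards [hv.fourier_sub hn hn4 hβ hs ht, ae_ne_zero hn] with ξ hξ hξ0
          have hw : (wt β ξ : ℂ) ≠ 0 := by exact_mod_cast (wt_pos hβ hξ0).ne'
          have h4 : ((Real.sqrt (t - s) : ℝ) : ℂ) ≠ 0 := by exact_mod_cast h3.ne'
          have h5 : ((t - s : ℝ) : ℂ) = ((Real.sqrt (t - s) : ℝ) : ℂ) ^ 2 := by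
            rw [← Complex.ofReal_pow, Real.sq_sqrt hpos.le]
          simp only [Pi.add_apply, Pi.smul_apply, smul_eq_mul, hψ]
          rw [hξ, h5, Complex.ofReal_mul]
          field_simp
      _ ≤ _ := eLpNorm_add_le hψm (hJmm.const_smul _) (by norm_num)
      _ ≤ _ := by
          gcongr
          rw [eLpNorm_const_smul, enorm_mul]
          have e1 : ‖((Real.sqrt (t - s) : ℝ) : ℂ)‖ₑ = ENNReal.ofReal (Real.sqrt (t - s)) := by
            rw [← ofReal_norm, Complex.norm_real, Real.norm_of_nonneg (by positivity)]
          have e2 : ‖Complex.I‖ₑ = 1 := by rw [← ofReal_norm, Complex.norm_I, ENNReal.ofReal_one]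
          have e3 : eLpNorm (fun ξ => phase β (-(t - s)) ξ * meanForce β v s t ξ) 2 volume =
              eLpNorm (meanForce β v s t) 2 volume :=
            eLpNorm_congr_norm_ae (Eventually.of_forall fun ξ => by
              rw [norm_mul, norm_phase, one_mul])
          rw [e1, e2, e3, mul_one]
          gcongr
  have key2 := ((ENNReal.tendsto_toReal ENNReal.zero_ne_top).comp key).pow 2
  simp only [ENNReal.toReal_zero, ne_eq, OfNat.ofNat_ne_zero, not_false_eq_true, zero_pow] at key2
  refine key2.congr' ?_
  filter_upwards [hmem] with t ht
  have hpos : 0 < t - s := sub_pos.2 ht.1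
  rw [Function.comp, ENNReal.toReal_ofReal (by positivity), mul_pow, inv_pow,
    Real.sq_sqrt hpos.le]

/-- The linear term of the increment of the potential energy. -/
theorem IsSmoothSolution.tendsto_integral_cubic_mul_sub (hn : 1 ≤ n) (hn4 : n ≤ 4) (hβ : 0 < β)
    (hβn : β < n / 2) (hv : IsSmoothSolution β T v) (hs : s ∈ Ico 0 T) :
    Tendsto (fun t => (t - s)⁻¹ * (∫ x, (starRingEnd ℂ) (cubic (v s) x) * (v t - v s : L2 n) x).re)
      (𝓝[>] s) (𝓝 (Complex.I * energyPairing β (v s)).re) := by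
  have hs' : s ∈ Icc 0 T := ⟨hs.1, hs.2.le⟩
  have hms := hv.mem 4 s hs'
  have hmem : ∀ᶠ t in 𝓝[>] s, t ∈ Ioc s T := Ioc_mem_nhdsGT hs.2
  obtain ⟨M, hM⟩ := exists_norm_le hn hn4 hβ hms
  obtain ⟨hJ, hJm⟩ := hv.tendsto_meanForce_one hn hn4 hβ hs
  have hG := memLp_cubicHat hn hn4 hβ hms
  have hG' := memLp_wtDual_cubicHat hn hn4 hβ hβn hms
  have hV := hv.memLp_wt_fourier hs'
  -- The difference quotient of the group divided by the symbol: it is bounded by `1` and tends to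
  -- `-i`. The symbol it leaves over is shared between solution and force as `wt * wtDual`.
  set φ : ℝ → E n → ℂ := fun t ξ =>
    (phase β (-(t - s)) ξ - 1) / (((t - s) * symb β ξ : ℝ) : ℂ) with hφ
  have hφm : ∀ t, Measurable (φ t) := fun t => by
    exact Measurable.div (by fun_prop) (by fun_prop)
  have hφb : ∀ t ∈ Ioc s T, ∀ᵐ ξ, ‖φ t ξ‖ ≤ 1 := by
    intro t ht
    have hpos : 0 < t - s := sub_pos.2 ht.1
    filter_upwards [ae_ne_zero hn] with ξ hξ
    have h1 := norm_phase_sub_one_le (β := β) (-(t - s)) ξ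
    have h2 := symb_pos (β := β) hξ
    rw [abs_neg, abs_of_pos hpos] at h1
    rw [hφ, norm_div, Complex.norm_real, Real.norm_of_nonneg (by positivity)]
    exact div_le_one_of_le₀ h1 (by positivity)
  have hfst : Tendsto (fun t => eLpNorm (fun ξ => φ t ξ * ((wt β ξ : ℂ) * (𝓕 (v s) : L2 n) ξ) -
      (-Complex.I) * ((wt β ξ : ℂ) * (𝓕 (v s) : L2 n) ξ)) 2 volume) (𝓝[>] s) (𝓝 0) := by
    simp only [← sub_mul]
    refine tendsto_eLpNorm_mul_of_bounded hV 2 (Eventually.of_forall fun t =>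
      ((hφm t).sub measurable_const).aestronglyMeasurable) ?_ ?_
    · filter_upwards [hmem] with t ht
      filter_upwards [hφb t ht] with ξ hξ
      refine (norm_sub_le _ _).trans ?_
      rw [norm_neg, Complex.norm_I]
      linarith
    · filter_upwards [ae_ne_zero hn] with ξ hξ
      have := (tendsto_phase_slope (β := β) (s := s) hξ).sub_const (-Complex.I)
      rw [sub_self] at this
      exact this
  have hfstm : ∀ᶠ t in 𝓝[>] s, MemLp (fun ξ => φ t ξ * ((wt β ξ : ℂ) * (𝓕 (v s) : L2 n) ξ))
      2 volume := by
    filter_upwards [hmem] with t ht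
    refine hV.of_le ((hφm t).aestronglyMeasurable.mul hV.1) ?_
    filter_upwards [hφb t ht] with ξ hξ
    rw [norm_mul]
    exact mul_le_of_le_one_left (norm_nonneg _) hξ
  have hsnd : Tendsto (fun t => eLpNorm (fun ξ => Complex.I * (phase β (-(t - s)) ξ *
      meanForce β v s t ξ) - Complex.I * cubicHat (v s) ξ) 2 volume) (𝓝[>] s) (𝓝 0) := by
    have h1 := tendsto_eLpNorm_mul_of_bounded (l := 𝓝[>] s)
      (φ := fun t ξ => phase β (-(t - s)) ξ - 1) hG 2
      (Eventually.of_forall fun t => by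
        exact Measurable.aestronglyMeasurable (by fun_prop))
      (Eventually.of_forall fun t => Eventually.of_forall fun ξ => norm_phase_sub_one_le_two _ _)
      (Eventually.of_forall fun ξ => tendsto_phase_neg_sub ξ)
    have h2 := h1.add hJ
    rw [add_zero] at h2
    refine tendsto_of_tendsto_of_tendsto_of_le_of_le' tendsto_const_nhds h2
      (Eventually.of_forall fun _ => zero_le) ?_
    filter_upwards [hJm] with t hJt
    calc _ = eLpNorm (fun ξ => (phase β (-(t - s)) ξ - 1) * cubicHat (v s) ξ +
          phase β (-(t - s)) ξ * (meanForce β v s t ξ - cubicHat (v s) ξ)) 2 volume := by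
          refine eLpNorm_congr_norm_ae (Eventually.of_forall fun ξ => ?_)
          rw [← mul_sub, norm_mul, Complex.norm_I, one_mul]
          congr 1; ring
      _ ≤ _ := eLpNorm_add_le
          (AEStronglyMeasurable.mul (Measurable.aestronglyMeasurable (by fun_prop)) hG.1)
          (AEStronglyMeasurable.mul (by fun_prop) (hJt.1.sub hG.1)) (by norm_num)
      _ = _ := by
          congr 1
          refine eLpNorm_congr_norm_ae (Eventually.of_forall fun ξ => ?_)
          rw [norm_mul, norm_phase, one_mul]
  have hsndm : ∀ᶠ t in 𝓝[>] s, MemLp (fun ξ => Complex.I * (phase β (-(t - s)) ξ *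
      meanForce β v s t ξ)) 2 volume := by
    filter_upwards [hJm] with t hJt
    refine hJt.of_le (AEStronglyMeasurable.const_mul
      (AEStronglyMeasurable.mul (by fun_prop) hJt.1) _) (Eventually.of_forall fun ξ => ?_)
    rw [norm_mul, norm_mul, norm_phase, Complex.norm_I, one_mul, one_mul]
  have hL1 := tendsto_integral_conj_mul (l := 𝓝[>] s) (Eventually.of_forall fun _ => hG') hfstm hG'
    (hV.const_mul (-Complex.I)) (by simp) hfst
  have hL2 := tendsto_integral_conj_mul (l := 𝓝[>] s) (Eventually.of_forall fun _ => hG) hsndm hG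
    (hG.const_mul Complex.I) (by simp) hsnd
  have hL := (Complex.continuous_re.tendsto _).comp (hL1.add hL2)
  have e1 : ∫ ξ, (starRingEnd ℂ) ((wtDual β ξ : ℂ) * cubicHat (v s) ξ) *
      (-Complex.I * ((wt β ξ : ℂ) * (𝓕 (v s) : L2 n) ξ)) =
      (starRingEnd ℂ) (Complex.I * energyPairing β (v s)) := by
    rw [map_mul, Complex.conj_I, energyPairing, ← integral_conj, ← integral_const_mul]
    congr 1; ext ξ
    rw [map_mul (starRingEnd ℂ) ((starRingEnd ℂ) _), Complex.conj_conj]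
    ring
  -- The force paired with `i` times itself is purely imaginary, so only the linear part of the
  -- increment survives.
  have e2 : (∫ ξ, (starRingEnd ℂ) (cubicHat (v s) ξ) * (Complex.I * cubicHat (v s) ξ)).re = 0 := by
    have : ∀ ξ, (starRingEnd ℂ) (cubicHat (v s) ξ) * (Complex.I * cubicHat (v s) ξ) =
        Complex.I * ((‖cubicHat (v s) ξ‖ ^ 2 : ℝ) : ℂ) := by
      intro ξ
      rw [mul_left_comm, mul_comm ((starRingEnd ℂ) _), Complex.mul_conj,
        Complex.normSq_eq_norm_sq]
    simp only [this]
    rw [integral_const_mul, integral_complex_ofReal]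
    simp
  rw [Complex.add_re, e1, e2, Complex.conj_re, add_zero] at hL
  refine hL.congr' ?_
  filter_upwards [hmem, hfstm, hsndm] with t ht h1 h2
  have hpos : 0 < t - s := sub_pos.2 ht.1
  have hc : ((t - s : ℝ) : ℂ) ≠ 0 := by exact_mod_cast hpos.ne'
  rw [Function.comp, ← integral_fourier_mul_conj (integrable_cubic hM) (memLp_cubic hM),
    ← integral_add (integrable_conj_mul hG' h1) (integrable_conj_mul hG h2),
    ← Complex.re_ofReal_mul, ← integral_const_mul]
  congr 1
  refine integral_congr_ae ?_
  filter_upwards [hv.fourier_sub hn hn4 hβ hs ht, ae_ne_zero hn] with ξ hξ hξ0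
  have hm : (symb β ξ : ℂ) ≠ 0 := by exact_mod_cast (symb_pos hξ0).ne'
  have hw : (wt β ξ : ℂ) * (wtDual β ξ : ℂ) = (symb β ξ : ℂ) := by
    exact_mod_cast wt_mul_wtDual hβ hξ0
  have hφe : φ t ξ * (symb β ξ : ℂ) = ((t - s : ℝ) : ℂ)⁻¹ * (phase β (-(t - s)) ξ - 1) := by
    simp only [hφ, Complex.ofReal_mul]
    field_simp
  rw [hξ, map_mul, Complex.conj_ofReal, ← cubicHat_eq, Complex.ofReal_inv]
  have hci : ((t - s : ℝ) : ℂ)⁻¹ * ((t - s : ℝ) : ℂ) = 1 := inv_mul_cancel₀ hc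
  linear_combination (starRingEnd ℂ) (cubicHat (v s) ξ) * (𝓕 (v s) : L2 n) ξ * φ t ξ * hw +
    (starRingEnd ℂ) (cubicHat (v s) ξ) * (𝓕 (v s) : L2 n) ξ * hφe -
    (starRingEnd ℂ) (cubicHat (v s) ξ) *
      (Complex.I * (phase β (-(t - s)) ξ * meanForce β v s t ξ)) * hci

theorem integrable_norm_pow_four {u : L2 n} {M : ℝ} (hu : ∀ᵐ x, ‖u x‖ ≤ M) :
    Integrable (fun x => ‖u x‖ ^ 4) := by
  have h : Integrable (fun x => M ^ 2 * ‖u x‖ ^ 2) :=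
    ((memLp_two_iff_integrable_sq_norm (Lp.aestronglyMeasurable u)).1 (Lp.memLp u)).const_mul _
  refine h.mono' ((Lp.aestronglyMeasurable u).norm.pow 4) ?_
  filter_upwards [hu] with x hx
  rw [Real.norm_of_nonneg (by positivity), show ‖u x‖ ^ 4 = ‖u x‖ ^ 2 * ‖u x‖ ^ 2 by ring]
  gcongr

/-- The pointwise expansion of `|·|⁴` is integrated with a bound `M` uniform near `s`. The linear
term has the limit found above, and the remainder is at most `18 M² ‖v t - v s‖²`, which is `o(t -
s)`. -/
theorem IsSmoothSolution.hasDerivWithinAt_potential (hn : 1 ≤ n) (hn4 : n ≤ 4) (hβ : 0 < β)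
    (hβn : β < n / 2) (hv : IsSmoothSolution β T v) (hs : s ∈ Ico 0 T) :
    HasDerivWithinAt (fun t => ∫ x, ‖v t x‖ ^ 4)
      (4 * (Complex.I * energyPairing β (v s)).re) (Ici s) s := by
  have hs' : s ∈ Icc 0 T := ⟨hs.1, hs.2.le⟩
  have hl := hv.tendsto_nhdsGT hs
  have hms := hv.mem 4 s hs'
  obtain ⟨M, hM0, hM, hMv⟩ := exists_eventually_norm_le hn hn4 hβ hms hl
  have hmem : ∀ᶠ t in 𝓝[>] s, t ∈ Ioc s T := Ioc_mem_nhdsGT hs.2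
  rw [← hasDerivWithinAt_Ioi_iff_Ici, hasDerivWithinAt_iff_tendsto_slope' (by simp)]
  have h1 := (hv.tendsto_integral_cubic_mul_sub hn hn4 hβ hβn hs).const_mul 4
  have h2 := (hv.tendsto_norm_sub_sq_div hn hn4 hβ hs).const_mul (18 * M ^ 2)
  rw [mul_zero] at h2
  rw [tendsto_iff_dist_tendsto_zero] at h1 ⊢
  have h3 := h1.add h2
  rw [add_zero] at h3
  refine tendsto_of_tendsto_of_tendsto_of_le_of_le' tendsto_const_nhds h3
    (Eventually.of_forall fun _ => dist_nonneg) ?_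
  filter_upwards [hmem, hMv] with t ht hMt
  refine (dist_triangle _ (4 * ((t - s)⁻¹ * (∫ x, (starRingEnd ℂ) (cubic (v s) x) *
    (v t - v s : L2 n) x).re)) _).trans ?_
  rw [add_comm]
  gcongr
  have hpos : 0 < t - s := sub_pos.2 ht.1
  have hi4t := integrable_norm_pow_four hMt
  have hi4s := integrable_norm_pow_four hM
  have hic : Integrable (fun x => (starRingEnd ℂ) (cubic (v s) x) * (v t - v s : L2 n) x) :=
    integrable_conj_mul (memLp_cubic hM) (Lp.memLp _)
  have hic4 : Integrable (fun x => 4 * ((starRingEnd ℂ) (cubic (v s) x) * (v t - v s : L2 n) x).re) :=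
    hic.re.const_mul 4
  have hre : (∫ x, (starRingEnd ℂ) (cubic (v s) x) * (v t - v s : L2 n) x).re =
      ∫ x, ((starRingEnd ℂ) (cubic (v s) x) * (v t - v s : L2 n) x).re := (integral_re hic).symm
  have hsq : Integrable (fun x => ‖(v t - v s : L2 n) x‖ ^ 2) :=
    (memLp_two_iff_integrable_sq_norm (Lp.aestronglyMeasurable _)).1 (Lp.memLp _)
  rw [Real.dist_eq, slope_def_field, hre, div_eq_inv_mul, mul_left_comm 4, ← mul_sub, abs_mul,
    abs_of_nonneg (inv_nonneg.2 hpos.le), mul_left_comm _ (t - s)⁻¹]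
  gcongr
  have hi4 : Integrable (fun x => ‖v t x‖ ^ 4 - ‖v s x‖ ^ 4) := hi4t.sub hi4s
  rw [norm_sq_eq_integral, ← integral_const_mul, ← integral_sub hi4t hi4s, ← integral_const_mul,
    ← integral_sub hi4 hic4]
  refine (abs_integral_le_integral_abs).trans (integral_mono_ae ?_ (hsq.const_mul _) ?_)
  · exact (hi4.sub hic4).abs
  · filter_upwards [hM, hMt, Lp.coeFn_sub (v t) (v s)] with x hx1 hx2 hx3
    simp only [hx3, Pi.sub_apply]
    exact abs_norm_pow_four_sub_le hx1 hx2

end smooth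

/-! ### Continuity of the norms and of the energy on `X_β`. -/

section norms

variable {n : ℕ} {β κ ϱ : ℝ}

theorem enorm_le_eX (β : ℝ) (u : L2 n) : ‖u‖ₑ ≤ eX β u := by
  calc ‖u‖ₑ = (‖u‖ₑ ^ 2) ^ (1 / 2 : ℝ) := by
        rw [← ENNReal.rpow_natCast, ← ENNReal.rpow_mul]; norm_num
    _ ≤ _ := by
        unfold eX; gcongr; rw [add_assoc]; exact le_self_add

theorem eD_one_le_eX (β : ℝ) (u : L2 n) : eD 1 u ≤ eX β u := by
  calc eD 1 u = (eD 1 u ^ 2) ^ (1 / 2 : ℝ) := by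
        rw [← ENNReal.rpow_natCast, ← ENNReal.rpow_mul]; norm_num
    _ ≤ _ := by
        unfold eX; gcongr; rw [add_right_comm]; exact le_add_self

theorem eD_neg_le_eX (β : ℝ) (u : L2 n) : eD (-β) u ≤ eX β u := by
  calc eD (-β) u = (eD (-β) u ^ 2) ^ (1 / 2 : ℝ) := by
        rw [← ENNReal.rpow_natCast, ← ENNReal.rpow_mul]; norm_num
    _ ≤ _ := by
        unfold eX; gcongr; exact le_add_self

theorem eLpNorm_two_toReal_sq {α : Type*} [MeasurableSpace α] {μ : Measure α} {f : α → ℂ}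
    (hf : MemLp f 2 μ) : (eLpNorm f 2 μ).toReal ^ 2 = ∫ x, ‖f x‖ ^ 2 ∂μ := by
  have hm : AEStronglyMeasurable (fun x => ‖f x‖ ^ 2) μ := hf.1.norm.pow 2
  rw [← ENNReal.toReal_pow, eLpNorm_two_sq,
    integral_eq_lintegral_of_nonneg_ae (Eventually.of_forall fun x => by positivity) hm]
  congr 1
  refine lintegral_congr fun x => ?_
  rw [ENNReal.ofReal_pow (norm_nonneg _), ofReal_norm]

theorem eLpNorm_four_toReal_pow (u : L2 n) :
    (eLpNorm u 4 volume).toReal ^ 4 = ∫ x, ‖u x‖ ^ 4 := by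
  have h4 : eLpNorm u 4 volume ^ 4 = ∫⁻ x, ‖u x‖ₑ ^ 4 := by
    have := eLpNorm_nnreal_pow_eq_lintegral (μ := volume) (f := u) (p := 4) (by norm_num)
    simp only [NNReal.coe_ofNat, ENNReal.coe_ofNat, ENNReal.rpow_ofNat] at this
    exact this
  have hm : AEStronglyMeasurable (fun x => ‖u x‖ ^ 4) volume :=
    (Lp.aestronglyMeasurable u).norm.pow 4
  rw [← ENNReal.toReal_pow, h4,
    integral_eq_lintegral_of_nonneg_ae (Eventually.of_forall fun x => by positivity) hm]
  congr 1
  refine lintegral_congr fun x => ?_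
  rw [ENNReal.ofReal_pow (norm_nonneg _), ofReal_norm]

theorem normD_sq {s : ℝ} {u : L2 n} (hu : eD s u < ∞) :
    normD s u ^ 2 = ∫ ξ, ((2 * Real.pi * ‖ξ‖) ^ s) ^ 2 * ‖(𝓕 u : L2 n) ξ‖ ^ 2 ∧
    Integrable (fun ξ : E n => ((2 * Real.pi * ‖ξ‖) ^ s) ^ 2 * ‖(𝓕 u : L2 n) ξ‖ ^ 2) := by
  have hm : MemLp (fun ξ : E n => (((2 * Real.pi * ‖ξ‖) ^ s : ℝ) : ℂ) * (𝓕 u : L2 n) ξ) 2 volume :=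
    ⟨AEStronglyMeasurable.mul (Measurable.aestronglyMeasurable (by fun_prop))
      (Lp.aestronglyMeasurable _), hu⟩
  have e : ∀ ξ : E n, ‖(((2 * Real.pi * ‖ξ‖) ^ s : ℝ) : ℂ) * (𝓕 u : L2 n) ξ‖ ^ 2 =
      ((2 * Real.pi * ‖ξ‖) ^ s) ^ 2 * ‖(𝓕 u : L2 n) ξ‖ ^ 2 := by
    intro ξ
    rw [norm_mul, Complex.norm_real, mul_pow, Real.norm_eq_abs, sq_abs]
  have h1 := eLpNorm_two_toReal_sq hm
  have h2 := (memLp_two_iff_integrable_sq_norm hm.1).1 hm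
  simp only [e] at h1 h2
  exact ⟨h1, h2⟩

theorem energy_eq {u : L2 n} (hu : MemX β u) :
    energy β u = 1 / 2 * (∫ ξ, symb β ξ * ‖(𝓕 u : L2 n) ξ‖ ^ 2) - 1 / 4 * ∫ x, ‖u x‖ ^ 4 := by
  obtain ⟨h1, h1i⟩ := normD_sq ((eD_one_le_eX β u).trans_lt hu)
  obtain ⟨h2, h2i⟩ := normD_sq ((eD_neg_le_eX β u).trans_lt hu)
  rw [energy, eLpNorm_four_toReal_pow, h1, h2, ← mul_add, ← integral_add h1i h2i]
  congr 3
  ext ξ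
  rw [symb_eq, Real.rpow_one]
  ring

theorem eD_le_add (s : ℝ) (u v : L2 n) : eD s u ≤ eD s (u - v) + eD s v :=
  eLpNorm_weight_fourier_le_add (by fun_prop) u v

theorem eD_neg_eq (s : ℝ) (u : L2 n) : eD s (-u) = eD s u := by
  have : (𝓕 (-u) : L2 n) = -𝓕 u := (Lp.fourierTransformₗᵢ (E n) ℂ).map_neg u
  unfold eD
  rw [this]
  refine eLpNorm_congr_norm_ae ?_
  filter_upwards [Lp.coeFn_neg (𝓕 u : L2 n)] with ξ hξ
  rw [hξ, Pi.neg_apply, norm_mul, norm_mul, norm_neg]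

theorem tendsto_toReal_of_le_add {ι : Type*} {l : Filter ι} {a d : ι → ℝ≥0∞} {b : ℝ≥0∞}
    (hb : b ≠ ∞) (h1 : ∀ i, a i ≤ d i + b) (h2 : ∀ i, b ≤ d i + a i) (hd : Tendsto d l (𝓝 0)) :
    Tendsto (fun i => (a i).toReal) l (𝓝 b.toReal) := by
  refine (ENNReal.tendsto_toReal hb).comp ?_
  have h3 : Tendsto (fun i => d i + b) l (𝓝 b) := by simpa using hd.add_const b
  have h4 : Tendsto (fun i => b - d i) l (𝓝 b) := by
    simpa using ENNReal.Tendsto.sub (tendsto_const_nhds (x := b)) hd (Or.inl hb)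
  exact tendsto_of_tendsto_of_tendsto_of_le_of_le h4 h3
    (fun i => tsub_le_iff_left.2 (h2 i)) h1

/-- The three exponents of the embedding add up to `4`, and each norm is at most the `X_β` norm.
This is what makes the `L⁴` part of the energy continuous on `X_β`. -/
theorem eLpNorm_four_le (hβ : 0 < β) (hκ : 0 ≤ κ) (hnκ : 0 ≤ 4 - n - 4 * κ) (hϱ : 0 < ϱ)
    (hemb : IsEmbeddingConstant n β κ ϱ) {u : L2 n} (hu : MemX β u) :
    eLpNorm u 4 volume ^ 4 ≤ ENNReal.ofReal ϱ * eX β u ^ 4 := by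
  refine (hemb u hu).trans ?_
  set X := (eX β u).toReal with hX
  have hXe : eX β u = ENNReal.ofReal X := (ENNReal.ofReal_toReal hu.ne).symm
  have hX0 : 0 ≤ X := ENNReal.toReal_nonneg
  have h1 : ‖u‖ ≤ X := by simpa using ENNReal.toReal_mono hu.ne (enorm_le_eX β u)
  have h2 : normD 1 u ≤ X := ENNReal.toReal_mono hu.ne (eD_one_le_eX β u)
  have h3 : normD (-β) u ≤ X := ENNReal.toReal_mono hu.ne (eD_neg_le_eX β u)
  have h2' : 0 ≤ normD 1 u := ENNReal.toReal_nonneg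
  have h3' : 0 ≤ normD (-β) u := ENNReal.toReal_nonneg
  have hp2 : 0 ≤ (n : ℝ) + 4 * κ * β / (β + 1) := by positivity
  have hp3 : 0 ≤ 4 * κ / (β + 1) := by positivity
  rw [hXe, ← ENNReal.ofReal_pow hX0, ← ENNReal.ofReal_mul hϱ.le, mul_assoc, mul_assoc]
  refine ENNReal.ofReal_le_ofReal (mul_le_mul_of_nonneg_left ?_ hϱ.le)
  calc _ ≤ X ^ (4 - n - 4 * κ) * (X ^ (n + 4 * κ * β / (β + 1)) * X ^ (4 * κ / (β + 1))) := by
        gcongr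
    _ = X ^ (4 : ℝ) := by
        rw [← Real.rpow_add_of_nonneg hX0 hp2 hp3,
          ← Real.rpow_add_of_nonneg hX0 hnκ (add_nonneg hp2 hp3)]
        congr 1
        field_simp
        ring
    _ = X ^ 4 := by norm_cast

section tendsto

variable {ι : Type*} {l : Filter ι} {u : ι → L2 n} {w : L2 n}

theorem tendsto_mass_of_eX (h : Tendsto (fun i => eX β (u i - w)) l (𝓝 0)) :
    Tendsto (fun i => mass (u i)) l (𝓝 (mass w)) := by
  have h1 : Tendsto (fun i => ‖u i - w‖ₑ) l (𝓝 0) :=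
    tendsto_of_tendsto_of_tendsto_of_le_of_le tendsto_const_nhds h (fun _ => zero_le)
      fun _ => enorm_le_eX β _
  have h2 : Tendsto u l (𝓝 w) := by
    rw [tendsto_iff_edist_tendsto_0]
    simpa only [edist_eq_enorm_sub] using h1
  exact h2.norm.pow 2

theorem tendsto_normD_of_eD {s : ℝ} (hw : eD s w < ∞)
    (h : Tendsto (fun i => eD s (u i - w)) l (𝓝 0)) :
    Tendsto (fun i => normD s (u i)) l (𝓝 (normD s w)) :=
  tendsto_toReal_of_le_add hw.ne (fun i => eD_le_add s (u i) w) (fun i => by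
    rw [← neg_sub w, eD_neg_eq]; exact eD_le_add s w (u i)) h

theorem tendsto_normD_one (hw : MemX β w) (h : Tendsto (fun i => eX β (u i - w)) l (𝓝 0)) :
    Tendsto (fun i => normD 1 (u i)) l (𝓝 (normD 1 w)) :=
  tendsto_normD_of_eD ((eD_one_le_eX β w).trans_lt hw)
    (tendsto_of_tendsto_of_tendsto_of_le_of_le tendsto_const_nhds h (fun _ => zero_le)
      fun _ => eD_one_le_eX β _)

theorem tendsto_normD_neg (hw : MemX β w) (h : Tendsto (fun i => eX β (u i - w)) l (𝓝 0)) :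
    Tendsto (fun i => normD (-β) (u i)) l (𝓝 (normD (-β) w)) :=
  tendsto_normD_of_eD ((eD_neg_le_eX β w).trans_lt hw)
    (tendsto_of_tendsto_of_tendsto_of_le_of_le tendsto_const_nhds h (fun _ => zero_le)
      fun _ => eD_neg_le_eX β _)

theorem tendsto_normXdot (hw : MemX β w) (h : Tendsto (fun i => eX β (u i - w)) l (𝓝 0)) :
    Tendsto (fun i => normXdot β (u i)) l (𝓝 (normXdot β w)) :=
  (((tendsto_normD_one hw h).pow 2).add ((tendsto_normD_neg hw h).pow 2)).sqrt

theorem tendsto_energy (hβ : 0 < β) (hκ : 0 ≤ κ) (hnκ : 0 ≤ 4 - n - 4 * κ) (hϱ : 0 < ϱ)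
    (hemb : IsEmbeddingConstant n β κ ϱ) (hw : MemX β w)
    (h : Tendsto (fun i => eX β (u i - w)) l (𝓝 0)) :
    Tendsto (fun i => energy β (u i)) l (𝓝 (energy β w)) := by
  have hd4 : Tendsto (fun i => eLpNorm (u i - w : L2 n) 4 volume ^ 4) l (𝓝 0) := by
    have h1 := ENNReal.Tendsto.const_mul (a := ENNReal.ofReal ϱ)
      ((ENNReal.continuous_pow 4).tendsto 0 |>.comp h) (Or.inr ENNReal.ofReal_ne_top)
    simp only [ne_eq, OfNat.ofNat_ne_zero, not_false_eq_true, zero_pow, mul_zero] at h1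
    refine tendsto_of_tendsto_of_tendsto_of_le_of_le' tendsto_const_nhds h1
      (Eventually.of_forall fun _ => zero_le) ?_
    filter_upwards [h.eventually (eventually_lt_nhds ENNReal.zero_lt_top)] with i hi
    exact eLpNorm_four_le hβ hκ hnκ hϱ hemb hi
  have hd : Tendsto (fun i => eLpNorm (u i - w : L2 n) 4 volume) l (𝓝 0) := by
    have := (ENNReal.continuous_rpow_const (y := 1 / 4)).tendsto 0 |>.comp hd4
    rw [ENNReal.zero_rpow_of_pos (by norm_num)] at this
    refine this.congr fun i => ?_
    rw [Function.comp, ← ENNReal.rpow_natCast, ← ENNReal.rpow_mul]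
    norm_num
  have hw4 : eLpNorm w 4 volume ≠ ∞ := by
    intro htop
    have h1 := eLpNorm_four_le hβ hκ hnκ hϱ hemb hw
    rw [htop, ENNReal.top_pow (by norm_num), top_le_iff] at h1
    exact ENNReal.mul_ne_top ENNReal.ofReal_ne_top (ENNReal.pow_ne_top hw.ne) h1
  have tri : ∀ a b : L2 n, eLpNorm a 4 volume ≤ eLpNorm (a - b : L2 n) 4 volume +
      eLpNorm b 4 volume := by
    intro a b
    refine le_trans (le_of_eq (eLpNorm_congr_ae ?_)) (eLpNorm_add_le
      (Lp.aestronglyMeasurable (a - b)) (Lp.aestronglyMeasurable b) (by norm_num))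
    filter_upwards [Lp.coeFn_sub a b] with x hx
    rw [Pi.add_apply, hx, Pi.sub_apply, sub_add_cancel]
  have h4 := tendsto_toReal_of_le_add (a := fun i => eLpNorm (u i) 4 volume) hw4
    (fun i => tri (u i) w) (fun i => by
      refine (tri w (u i)).trans (add_le_add_left (le_of_eq ?_) _)
      refine eLpNorm_congr_norm_ae ?_
      filter_upwards [Lp.coeFn_sub w (u i), Lp.coeFn_sub (u i) w] with x h1 h2
      rw [h1, h2, Pi.sub_apply, Pi.sub_apply, norm_sub_rev]) hd
  exact ((((tendsto_normD_one hw h).pow 2).const_mul _).add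
    (((tendsto_normD_neg hw h).pow 2).const_mul _)).sub ((h4.pow 4).const_mul _)

end tendsto

end norms

/-! ### Conservation of mass and energy. -/

section conservation

variable {n : ℕ} {β κ ϱ T : ℝ} {v : ℝ → L2 n}

theorem IsSmoothSolution.memX (hn : 1 ≤ n) (hβ : 0 < β) (hv : IsSmoothSolution β T v) {t : ℝ}
    (ht : t ∈ Icc 0 T) : MemX β (v t) :=
  (eX_le_eHs hn hβ _).trans_lt (ENNReal.mul_lt_top (by norm_num) (hv.mem 4 t ht))

theorem IsSmoothSolution.tendsto_eX (hn : 1 ≤ n) (hβ : 0 < β) (hv : IsSmoothSolution β T v) {t : ℝ}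
    (ht : t ∈ Icc 0 T) : Tendsto (fun τ => eX β (v τ - v t)) (𝓝[Icc 0 T] t) (𝓝 0) := by
  have h := ENNReal.Tendsto.const_mul (a := 2) (hv.cont 4 t ht) (Or.inr (by norm_num))
  rw [mul_zero] at h
  exact tendsto_of_tendsto_of_tendsto_of_le_of_le tendsto_const_nhds h (fun _ => zero_le)
    fun _ => eX_le_eHs hn hβ _

/-- Conservation of mass for smooth solutions. -/
theorem IsSmoothSolution.mass_eq (hn : 1 ≤ n) (hn4 : n ≤ 4) (hβ : 0 < β)
    (hv : IsSmoothSolution β T v) : ∀ t ∈ Icc 0 T, mass (v t) = mass (v 0) :=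
  constant_of_has_deriv_right_zero
    (fun _ ht => tendsto_mass_of_eX (hv.tendsto_eX hn hβ ht))
    fun _ hs => hv.hasDerivWithinAt_mass hn hn4 hβ hs

/-- Conservation of energy for smooth solutions. -/
theorem IsSmoothSolution.energy_eq (hn : 1 ≤ n) (hn4 : n ≤ 4) (hβ : 0 < β) (hβn : β < n / 2)
    (hκ : 0 ≤ κ) (hnκ : 0 ≤ 4 - n - 4 * κ) (hϱ : 0 < ϱ) (hemb : IsEmbeddingConstant n β κ ϱ)
    (hv : IsSmoothSolution β T v) : ∀ t ∈ Icc 0 T, energy β (v t) = energy β (v 0) := by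
  refine constant_of_has_deriv_right_zero
    (fun t ht => tendsto_energy hβ hκ hnκ hϱ hemb (hv.memX hn hβ ht) (hv.tendsto_eX hn hβ ht))
    fun s hs => ?_
  have h := ((hv.hasDerivWithinAt_kinetic hn hn4 hβ hβn hs).const_mul (1 / 2)).sub
    ((hv.hasDerivWithinAt_potential hn hn4 hβ hβn hs).const_mul (1 / 4))
  -- The cancellation behind energy conservation: both rates are multiples of the same pairing.
  have h0 : 1 / 2 * (2 * (Complex.I * energyPairing β (v s)).re) -
      1 / 4 * (4 * (Complex.I * energyPairing β (v s)).re) = 0 := by ring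
  rw [h0] at h
  refine h.congr_of_eventuallyEq_of_mem ?_ self_mem_Ici
  have hmem : Ico s T ∈ 𝓝[≥] s := Ico_mem_nhdsGE hs.2
  filter_upwards [hmem] with t ht
  exact NonlocalNLS.energy_eq (hv.memX hn hβ ⟨hs.1.trans ht.1, ht.2.le⟩)

variable {S : EReal} {u₀ : L2 n} {u : ℝ → L2 n}

/-- Conservation of mass and energy for strong solutions. -/
theorem IsSolution.conservation (hn : 1 ≤ n) (hn4 : n ≤ 4) (hβ : 0 < β) (hβn : β < n / 2)
    (hκ : 0 ≤ κ) (hnκ : 0 ≤ 4 - n - 4 * κ) (hϱ : 0 < ϱ) (hemb : IsEmbeddingConstant n β κ ϱ)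
    (hu : IsSolution β S u₀ u) {t : ℝ} (ht : t ∈ timeSet S) :
    mass (u t) = mass u₀ ∧ energy β (u t) = energy β u₀ := by
  obtain ⟨v, hv, hl⟩ := hu.approx t ht
  have h0 : (0 : ℝ) ∈ timeSet S := ⟨le_rfl, by exact_mod_cast hu.pos⟩
  have hconv : ∀ τ ∈ Icc 0 t, Tendsto (fun j => eX β (v j τ - u τ)) atTop (𝓝 0) := fun τ hτ =>
    tendsto_of_tendsto_of_tendsto_of_le_of_le tendsto_const_nhds hl (fun _ => zero_le)
      fun j => le_iSup₂ (f := fun t _ => eX β (v j t - u t)) τ hτ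
  have m0 : (0 : ℝ) ∈ Icc 0 t := ⟨le_rfl, ht.1⟩
  have mt : t ∈ Icc 0 t := ⟨ht.1, le_rfl⟩
  rw [← hu.init]
  constructor
  · refine tendsto_nhds_unique (tendsto_mass_of_eX (hconv t mt)) ?_
    refine (tendsto_mass_of_eX (hconv 0 m0)).congr fun j => ?_
    exact ((hv j).mass_eq hn hn4 hβ t mt).symm
  · refine tendsto_nhds_unique (tendsto_energy hβ hκ hnκ hϱ hemb (hu.mem t ht) (hconv t mt)) ?_
    refine (tendsto_energy hβ hκ hnκ hϱ hemb (hu.mem 0 h0) (hconv 0 m0)).congr fun j => ?_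
    exact ((hv j).energy_eq hn hn4 hβ hβn hκ hnκ hϱ hemb t mt).symm

end conservation

/-! ### Coercivity of the energy below its critical value. -/

section coercivity

variable {n : ℕ} {β κ m ϱ : ℝ}

/-- The minimum of the symbol `r² + r^{-2β}`. -/
theorem cConst_two_le_symb (hβ : 0 < β) {ξ : E n} (hξ : ξ ≠ 0) : cConst β 2 ≤ symb β ξ := by
  have hr := freq_pos hξ
  unfold symb
  generalize 2 * Real.pi * ‖ξ‖ = r at hr ⊢
  -- The weights `β/(β+1)` and `1/(β+1)` are those for which the powers of `r` cancel in the
  -- geometric mean; what remains is the constant.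
  have h := Real.geom_mean_le_arith_mean2_weighted (w₁ := β / (β + 1)) (w₂ := 1 / (β + 1))
    (p₁ := (β + 1) / β * r ^ 2) (p₂ := (β + 1) * r ^ (-(2 * β))) (by positivity) (by positivity)
    (by positivity) (by positivity) (by field_simp)
  have e1 : β / (β + 1) * ((β + 1) / β * r ^ 2) + 1 / (β + 1) * ((β + 1) * r ^ (-(2 * β))) =
      r ^ 2 + r ^ (-(2 * β)) := by field_simp
  rw [e1] at h
  refine le_trans (le_of_eq ?_) h
  have hr2 : r ^ 2 = r ^ (2 : ℝ) := by norm_cast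
  rw [hr2, cConst, Real.mul_rpow (by positivity) (by positivity),
    Real.mul_rpow (by positivity) (by positivity), Real.div_rpow (by positivity) hβ.le,
    ← Real.rpow_mul hr.le, ← Real.rpow_mul hr.le, div_eq_mul_inv ((β + 1) ^ _),
    ← Real.rpow_neg hβ.le]
  have e2 : (β + 1) ^ (β / (β + 1)) * β ^ (-(β / (β + 1))) * r ^ (2 * (β / (β + 1))) *
      ((β + 1) ^ (1 / (β + 1)) * r ^ (-(2 * β) * (1 / (β + 1)))) =
      ((β + 1) ^ (β / (β + 1)) * (β + 1) ^ (1 / (β + 1))) * β ^ (-(β / (β + 1))) *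
      (r ^ (2 * (β / (β + 1))) * r ^ (-(2 * β) * (1 / (β + 1)))) := by ring
  rw [e2, ← Real.rpow_add (by positivity), ← Real.rpow_add hr]
  have e3 : β / (β + 1) + 1 / (β + 1) = 1 := by field_simp
  have e4 : 2 * (β / (β + 1)) + -(2 * β) * (1 / (β + 1)) = 0 := by field_simp; ring
  rw [e3, e4, Real.rpow_zero, mul_one]
  congr 2
  · norm_num
  · field_simp

theorem cConst_pos (hβ : 0 < β) : 0 < cConst β m := by
  unfold cConst; positivity

theorem cConst_eq_rpow (hβ : 0 < β) : cConst β m = cConst β 2 ^ (m / 2) := by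
  unfold cConst
  rw [Real.mul_rpow (by positivity) (by positivity), ← Real.rpow_mul (by positivity),
    ← Real.rpow_mul hβ.le]
  congr 2
  · norm_num
  · field_simp

theorem normXdot_sq (u : L2 n) : normXdot β u ^ 2 = normD 1 u ^ 2 + normD (-β) u ^ 2 :=
  Real.sq_sqrt (by positivity)

theorem normXdot_nonneg (u : L2 n) : 0 ≤ normXdot β u := Real.sqrt_nonneg _

theorem normD_one_le_normXdot (u : L2 n) : normD 1 u ≤ normXdot β u :=
  Real.le_sqrt_of_sq_le (by nlinarith [sq_nonneg (normD (-β) u)])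

theorem normD_neg_le_normXdot (u : L2 n) : normD (-β) u ≤ normXdot β u :=
  Real.le_sqrt_of_sq_le (by nlinarith [sq_nonneg (normD 1 u)])

theorem cConst_mul_norm_sq_le (hn : 1 ≤ n) (hβ : 0 < β) {u : L2 n} (hu : MemX β u) :
    cConst β 2 * ‖u‖ ^ 2 ≤ normXdot β u ^ 2 := by
  obtain ⟨h1, h1i⟩ := normD_sq ((eD_one_le_eX β u).trans_lt hu)
  obtain ⟨h2, h2i⟩ := normD_sq ((eD_neg_le_eX β u).trans_lt hu)
  rw [normXdot_sq, h1, h2, ← integral_add h1i h2i, norm_sq_eq_integral_fourier,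
    ← integral_const_mul]
  refine integral_mono_ae (((memLp_two_iff_integrable_sq_norm (Lp.aestronglyMeasurable _)).1
    (Lp.memLp (𝓕 u : L2 n))).const_mul _) (h1i.add h2i) ?_
  filter_upwards [ae_ne_zero hn] with ξ hξ
  have h := cConst_two_le_symb hβ hξ
  rw [symb_eq] at h
  simp only [Real.rpow_one]
  rw [← add_mul]
  gcongr

/-- The power `m/2` of the spectral gap: `m` powers of the `Ẋ_β` norm are replaced by powers of the
conserved mass. -/
theorem cConst_mul_norm_rpow_le (hn : 1 ≤ n) (hβ : 0 < β) (hm : 0 ≤ m) {u : L2 n}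
    (hu : MemX β u) : cConst β m * ‖u‖ ^ m ≤ normXdot β u ^ m := by
  have h := Real.rpow_le_rpow (by have := cConst_pos (m := 2) hβ; positivity)
    (cConst_mul_norm_sq_le hn hβ hu) (z := m / 2) (by positivity)
  rw [Real.mul_rpow (cConst_pos hβ).le (by positivity), ← cConst_eq_rpow hβ] at h
  have e : ∀ a : ℝ, 0 ≤ a → (a ^ 2) ^ (m / 2) = a ^ m := by
    intro a ha
    rw [← Real.rpow_natCast, ← Real.rpow_mul ha]
    congr 1; push_cast; ring
  rwa [e _ (norm_nonneg _), e _ (normXdot_nonneg _)] at h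

/-- The lower bound of the energy in terms of `y = ‖u‖_{Ẋ_β}^{2-m}` and `‖u‖_{L²}`. -/
theorem le_energy (hn : 1 ≤ n) (hβ : 0 < β) (hκ : 0 ≤ κ) (hm : 0 ≤ m) (hm2 : m < 2)
    (hϱ : 0 < ϱ) (hemb : IsEmbeddingConstant n β κ ϱ) {u : L2 n} (hu : MemX β u) :
    1 / 2 * cConst β m * ‖u‖ ^ m * normXdot β u ^ (2 - m) - 1 / 4 * ϱ * ‖u‖ ^ (4 - n - 4 * κ) *
      (normXdot β u ^ (2 - m)) ^ (kExp n κ m / 2) ≤ energy β u := by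
  set x := normXdot β u with hx
  have hx0 : 0 ≤ x := normXdot_nonneg u
  have h2' : 0 ≤ normD 1 u := ENNReal.toReal_nonneg
  have h3' : 0 ≤ normD (-β) u := ENNReal.toReal_nonneg
  have hp2 : 0 ≤ (n : ℝ) + 4 * κ * β / (β + 1) := by positivity
  have hp3 : 0 ≤ 4 * κ / (β + 1) := by positivity
  have h4 : (eLpNorm u 4 volume).toReal ^ 4 ≤ ϱ * ‖u‖ ^ (4 - n - 4 * κ) * x ^ (n + 4 * κ) := by
    have h := ENNReal.toReal_mono ENNReal.ofReal_ne_top (hemb u hu)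
    rw [ENNReal.toReal_pow, ENNReal.toReal_ofReal (by positivity)] at h
    refine h.trans ?_
    rw [mul_assoc]
    refine mul_le_mul_of_nonneg_left ?_ (by positivity)
    calc _ ≤ x ^ (n + 4 * κ * β / (β + 1)) * x ^ (4 * κ / (β + 1)) := by
          gcongr
          · exact normD_one_le_normXdot u
          · exact normD_neg_le_normXdot u
      _ = _ := by
          rw [← Real.rpow_add_of_nonneg hx0 hp2 hp3]
          congr 1
          field_simp
          ring
  -- The exponent `k` is defined so that `(2 - m) k / 2 = n + 4κ`, the total power of the `Ẋ_β` norm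
  -- in the embedding.
  have e1 : (x ^ (2 - m)) ^ (kExp n κ m / 2) = x ^ (n + 4 * κ) := by
    rw [← Real.rpow_mul hx0, kExp]
    congr 1
    have : 2 - m ≠ 0 := by linarith
    field_simp
  have e2 : x ^ 2 = x ^ m * x ^ (2 - m) := by
    rw [← Real.rpow_add_of_nonneg hx0 hm (by linarith)]
    norm_num
  have h5 := mul_le_mul_of_nonneg_right (cConst_mul_norm_rpow_le hn hβ hm hu)
    (by positivity : 0 ≤ x ^ (2 - m))
  rw [← hx, ← e2] at h5
  have h6 : energy β u = 1 / 2 * x ^ 2 - 1 / 4 * (eLpNorm u 4 volume).toReal ^ 4 := by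
    rw [energy, hx, normXdot_sq]; ring
  rw [h6, e1]
  linarith

end coercivity

/-- The value of `y ↦ ½ c μ^m y - ¼ ϱ μ^p y^{k/2}` at its maximum point, where
`μ^θ`, `μ^m` and `μ^p` are balanced. -/
theorem critical_value {c ϱ μ k m p θ : ℝ} (hc : 0 < c) (hϱ : 0 < ϱ) (hμ : 0 < μ) (hk : 2 < k)
    (hbal : (m - p) * (2 / (k - 2)) + θ + m = 0) {y : ℝ}
    (hy : y = (4 * c / (ϱ * k)) ^ (2 / (k - 2)) * μ ^ (-(θ + m))) :
    1 / 2 * c * μ ^ m * y - 1 / 4 * ϱ * μ ^ p * y ^ (k / 2) = (k - 2) / (2 * k) * c * μ ^ m * y ∧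
    ((k - 2) / (2 * k) * c * μ ^ m * y) ^ (k - 2) * (μ ^ 2) ^ ((k - 2) * θ / 2) =
      c ^ k * ((k - 2) / (2 * k)) ^ (k - 2) * (4 / (ϱ * k)) ^ 2 := by
  have hk0 : 0 < k := by linarith
  have hk2 : 0 < k - 2 := by linarith
  set g := 4 * c / (ϱ * k) with hg
  have hg0 : 0 < g := by positivity
  have hy0 : 0 < y := by rw [hy]; positivity
  -- This is the critical point equation `½ c μ^m = (k/8) ϱ μ^p y^{k/2-1}`, solved for the power of
  -- `y`.
  have hyk : y ^ ((k - 2) / 2) = g * μ ^ (m - p) := by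
    rw [hy, Real.mul_rpow (by positivity) (by positivity), ← Real.rpow_mul hg0.le,
      ← Real.rpow_mul hμ.le]
    have e1 : 2 / (k - 2) * ((k - 2) / 2) = 1 := by field_simp
    have e2 : -(θ + m) * ((k - 2) / 2) = m - p := by
      have : -(θ + m) = (m - p) * (2 / (k - 2)) := by linarith
      rw [this]; field_simp
    rw [e1, e2, Real.rpow_one]
  constructor
  · have e1 : y ^ (k / 2) = y * (g * μ ^ (m - p)) := by
      rw [← hyk, ← Real.rpow_one_add' hy0.le (by linarith)]
      congr 1; ring
    have e2 : μ ^ p * μ ^ (m - p) = μ ^ m := by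
      rw [← Real.rpow_add hμ]; congr 1; ring
    have e3 : 1 / 4 * ϱ * μ ^ p * (y * (g * μ ^ (m - p))) =
        1 / 4 * ϱ * g * y * (μ ^ p * μ ^ (m - p)) := by ring
    rw [e1, e3, e2, hg]
    field_simp
  · have e1 : y ^ (k - 2) = g ^ 2 * (μ ^ (m - p)) ^ 2 := by
      rw [← mul_pow, ← hyk, ← Real.rpow_natCast, ← Real.rpow_mul hy0.le]
      congr 1; push_cast; ring
    have e2 : (μ ^ 2) ^ ((k - 2) * θ / 2) = μ ^ ((k - 2) * θ) := by
      rw [← Real.rpow_natCast, ← Real.rpow_mul hμ.le]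
      congr 1; push_cast; ring
    have e3 : (μ ^ (m - p)) ^ 2 = μ ^ (2 * (m - p)) := by
      rw [← Real.rpow_natCast, ← Real.rpow_mul hμ.le]
      congr 1; push_cast; ring
    -- The total exponent of `μ` is `k - 2` times the left side of `hbal`: `θ` is the power of the
    -- mass that makes the threshold independent of `μ`.
    have e4 : μ ^ (m * (k - 2)) * μ ^ (2 * (m - p)) * μ ^ ((k - 2) * θ) = 1 := by
      rw [← Real.rpow_add hμ, ← Real.rpow_add hμ]
      have : m * (k - 2) + 2 * (m - p) + (k - 2) * θ = 0 := by
        have h := congrArg (fun z => (k - 2) * z) hbal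
        simp only [mul_zero] at h
        field_simp at h
        linarith
      rw [this, Real.rpow_zero]
    have e5 : c ^ k = c ^ (k - 2) * c ^ 2 := by
      rw [← Real.rpow_natCast c 2, ← Real.rpow_add hc]
      congr 1; push_cast; ring
    rw [Real.mul_rpow (by positivity) hy0.le, Real.mul_rpow (by positivity) (by positivity),
      Real.mul_rpow (by positivity) hc.le, ← Real.rpow_mul hμ.le, e1, e2, e3, e5]
    calc _ = ((k - 2) / (2 * k)) ^ (k - 2) * c ^ (k - 2) * g ^ 2 *
          (μ ^ (m * (k - 2)) * μ ^ (2 * (m - p)) * μ ^ ((k - 2) * θ)) := by ring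
      _ = _ := by rw [e4, hg]; field_simp

/-! ### The uniform bound. -/

theorem eX_eq {n : ℕ} {β : ℝ} {u : L2 n} (hu : MemX β u) :
    eX β u = ENNReal.ofReal (Real.sqrt (‖u‖ ^ 2 + normXdot β u ^ 2)) := by
  have h1 : eD 1 u = ENNReal.ofReal (normD 1 u) :=
    (ENNReal.ofReal_toReal ((eD_one_le_eX β u).trans_lt hu).ne).symm
  have h2 : eD (-β) u = ENNReal.ofReal (normD (-β) u) :=
    (ENNReal.ofReal_toReal ((eD_neg_le_eX β u).trans_lt hu).ne).symm
  have h1' : 0 ≤ normD 1 u := ENNReal.toReal_nonneg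
  have h2' : 0 ≤ normD (-β) u := ENNReal.toReal_nonneg
  rw [eX, h1, h2, ← ofReal_norm, normXdot_sq, ← ENNReal.ofReal_pow (norm_nonneg _),
    ← ENNReal.ofReal_pow h1', ← ENNReal.ofReal_pow h2',
    ← ENNReal.ofReal_add (by positivity) (by positivity),
    ← ENNReal.ofReal_add (by positivity) (by positivity),
    ENNReal.ofReal_rpow_of_nonneg (by positivity) (by norm_num), Real.sqrt_eq_rpow, add_assoc]

end NonlocalNLS

theorem mainTheorem7 (n : ℕ) (hn : 1 ≤ n) (β κ m ϱ : ℝ) (hβ : 0 < β) (hβn : β < n / 2)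
    (hκ : 0 ≤ κ) (hm : 0 ≤ m) (hmκ : m / 2 ≤ 1 - κ - n / 4) (hk : 2 < kExp n κ m)
    (hϱ : 0 < ϱ) (hemb : IsEmbeddingConstant n β κ ϱ)
    (u₀ : L2 n) (hu₀ : MemX β u₀)
    (hcond1 : normXdot β u₀ ^ (2 - m) * mass u₀ ^ ((thetaExp n κ m + m) / 2) <
      (4 * cConst β m / (ϱ * kExp n κ m)) ^ (2 / (kExp n κ m - 2)))
    (hcond2 : energy β u₀ ^ (kExp n κ m - 2) *
        mass u₀ ^ ((kExp n κ m - 2) * thetaExp n κ m / 2) <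
      cConst β m ^ kExp n κ m *
        ((kExp n κ m - 2) / (2 * kExp n κ m)) ^ (kExp n κ m - 2) *
        (4 / (ϱ * kExp n κ m)) ^ 2) :
    ∃ K : ℝ≥0, ∀ (T : EReal) (u : ℝ → L2 n), IsSolution β T u₀ u →
      ∀ t ∈ timeSet T, eX β (u t) ≤ K := by
  have hn1 : (1 : ℝ) ≤ n := by exact_mod_cast hn
  -- The range of `m` and `κ` forces `n ≤ 4`, so the functions of `H⁴_β` are bounded.
  have hn4 : n ≤ 4 := by
    have : (n : ℝ) ≤ 4 := by linarith
    exact_mod_cast this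
  have hnκ : 0 ≤ 4 - (n : ℝ) - 4 * κ := by linarith
  have hm2 : m < 2 := by linarith
  have hcons : ∀ (T : EReal) (u : ℝ → L2 n), IsSolution β T u₀ u → ∀ t ∈ timeSet T,
      mass (u t) = mass u₀ ∧ energy β (u t) = energy β u₀ := fun T u hu t ht =>
    hu.conservation hn hn4 hβ hβn hκ hnκ hϱ hemb ht
  -- Zero mass is treated apart, because `y₁` contains the power `-(θ + m)` of `μ`; there mass
  -- conservation alone makes the solution vanish.
  rcases (norm_nonneg u₀).eq_or_lt with h0 | hμ
  · have hu0 : u₀ = 0 := norm_eq_zero.1 h0.symm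
    refine ⟨(eX β u₀).toNNReal, fun T u hu t ht => ?_⟩
    have h1 := (hcons T u hu t ht).1
    have h2 : u t = u₀ := by
      rw [mass, mass, ← h0, zero_pow two_ne_zero, sq_eq_zero_iff, norm_eq_zero] at h1
      rw [h1, hu0]
    rw [h2, ENNReal.coe_toNNReal hu₀.ne]
  set k := kExp n κ m with hkdef
  set θ := thetaExp n κ m with hθdef
  set c := cConst β m with hcdef
  set μ := ‖u₀‖ with hμdef
  have hc : 0 < c := cConst_pos hβ
  have hk2 : 0 < k - 2 := by linarith
  have hbal : (m - (4 - n - 4 * κ)) * (2 / (k - 2)) + θ + m = 0 := by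
    have h2m : 2 - m ≠ 0 := by linarith
    have hk' : k - 2 = 2 * (m - 2 + 4 * κ + n) / (2 - m) := by
      rw [hkdef, kExp]; field_simp; ring
    have hD : m - 2 + 4 * κ + n ≠ 0 := by
      intro h
      rw [hk', h] at hk2
      simp at hk2
    rw [hk', hθdef, thetaExp]
    field_simp
    ring
  set y₁ := (4 * c / (ϱ * k)) ^ (2 / (k - 2)) * μ ^ (-(θ + m)) with hy₁
  have hy₁0 : 0 < y₁ := by positivity
  obtain ⟨hval, hvalk⟩ := critical_value (p := 4 - n - 4 * κ) hc hϱ hμ hk hbal hy₁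
  have hlt0 : normXdot β u₀ ^ (2 - m) < y₁ := by
    have e : mass u₀ ^ ((θ + m) / 2) = μ ^ (θ + m) := by
      rw [mass, ← Real.rpow_natCast, ← Real.rpow_mul hμ.le]
      congr 1; push_cast; ring
    rw [e] at hcond1
    rw [hy₁, Real.rpow_neg hμ.le, ← div_eq_mul_inv, lt_div_iff₀ (by positivity)]
    exact hcond1
  have hE : energy β u₀ < (k - 2) / (2 * k) * c * μ ^ m * y₁ := by
    -- Arguing by contradiction makes the energy nonnegative before real powers are compared; a
    -- negative energy satisfies the bound anyway, whatever its real power is.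
    by_contra hcon
    rw [not_lt] at hcon
    have hpos : 0 ≤ (k - 2) / (2 * k) * c * μ ^ m * y₁ := by positivity
    have h1 := Real.rpow_le_rpow hpos hcon hk2.le
    have h2 := mul_le_mul_of_nonneg_right h1
      (by positivity : 0 ≤ (μ ^ 2) ^ ((k - 2) * θ / 2))
    rw [hvalk] at h2
    exact absurd hcond2 (not_lt.2 h2)
  -- `R` is the `Ẋ_β` norm at the barrier; it depends on `u₀` and the constants only, not on `T` or
  -- on the solution.
  set R := y₁ ^ (1 / (2 - m)) with hR
  have hR0 : 0 ≤ R := by positivity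
  refine ⟨(Real.sqrt (μ ^ 2 + R ^ 2)).toNNReal, fun T u hu t ht => ?_⟩
  have hsub : Icc 0 t ⊆ timeSet T := fun τ hτ =>
    ⟨hτ.1, lt_of_le_of_lt (by exact_mod_cast hτ.2) ht.2⟩
  have hnorm : ∀ τ ∈ timeSet T, ‖u τ‖ = μ := fun τ hτ => by
    have h := (hcons T u hu τ hτ).1
    rw [mass, mass] at h
    exact (sq_eq_sq₀ (norm_nonneg _) (norm_nonneg _)).1 h
  have hcont : ContinuousOn (fun τ => normXdot β (u τ) ^ (2 - m)) (Icc 0 t) := by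
    intro τ hτ
    have h1 := tendsto_normXdot (hu.mem τ (hsub hτ)) (hu.cont τ (hsub hτ))
    exact ((h1.mono_left (nhdsWithin_mono _ hsub)).rpow_const (Or.inr (by linarith)))
  -- At the barrier the lower bound of the energy equals its critical value, which exceeds the
  -- conserved energy. By the intermediate value theorem the barrier is then never crossed.
  have hne : ∀ τ ∈ Icc 0 t, normXdot β (u τ) ^ (2 - m) ≠ y₁ := by
    intro τ hτ heq
    have h1 := le_energy hn hβ hκ hm hm2 hϱ hemb (hu.mem τ (hsub hτ))
    rw [hnorm τ (hsub hτ), heq, ← hkdef, ← hcdef, hval, (hcons T u hu τ (hsub hτ)).2] at h1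
    exact absurd hE (not_lt.2 h1)
  have hlt : normXdot β (u t) ^ (2 - m) < y₁ := by
    by_contra hcon
    rw [not_lt] at hcon
    have h0 : normXdot β (u 0) ^ (2 - m) ≤ y₁ := by rw [hu.init]; exact hlt0.le
    obtain ⟨τ, hτ, hτe⟩ := intermediate_value_Icc ht.1 hcont ⟨h0, hcon⟩
    exact hne τ hτ hτe
  have hx : normXdot β (u t) ≤ R := by
    have h1 := Real.rpow_le_rpow (Real.rpow_nonneg (normXdot_nonneg _) _) hlt.le
      (z := 1 / (2 - m)) (div_nonneg zero_le_one (by linarith))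
    rw [← Real.rpow_mul (normXdot_nonneg _), mul_one_div_cancel (by linarith),
      Real.rpow_one] at h1
    exact h1
  rw [eX_eq (hu.mem t ht), hnorm t ht]
  refine ENNReal.ofReal_le_ofReal (Real.sqrt_le_sqrt ?_)
  have := normXdot_nonneg (β := β) (u t)
  gcongr
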